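/- Let $\nu\ge \tfrac12$ be real, and let $J_\nu$ and $Y_\nu$ be the Bessel functions of order $\nu$ of the first and second kind. For $x>0$, $y>0$ put $$u_\nu(x,y)=x^{1/2}\bigl(J_\nu(y)Y_\nu(xy)-J_\nu(xy)Y_\nu(y)\bigr).$$ Then for every $x>1$ and every integer $k\ge 1$ the function $y\mapsto u_\nu(x,y)$ has a $k$-th positive zero $y_{\nu,k}(x)$, that is, a zero $y_{\nu,k}(x)>0$ such that exactly $k$ zeros lie in $(0,y_{\nu,k}(x)]$. For every $k\ge 1$ the zero curve $y_{\nu,k}:(1,\infty)\to(0,\infty)$ is strictly decreasing and convex. Moreover $$y_{\nu,k+1}(x)-y_{\nu,k}(x)>\frac{\pi}{2x-1}\qquad(k\ge 2,\ x>1).$$ In particular, for every $b>1$, if $\rho_{\nu,1}<\rho_{\nu,2}<\cdots$ is the infinite sequence of positive zeros of $\rho\mapsto J_\nu(\rho)Y_\nu(\rho b)-J_\nu(\rho b)Y_\nu(\rho)$, then $$\rho_{\nu,m+1}-\rho_{\nu,m}>\frac{\pi}{2b-1}\qquad(m\ge 2).$$ -/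

import Mathlib

open Real Set Filter Topology

noncomputable section

/-- The Bessel function of the first kind `J_ν(t)` of real order `ν`, for `t > 0`:
`∑ₘ (-1)^m / (m! Γ(m + ν + 1)) (t/2)^(2m + ν)`. At the poles of `Γ`, Mathlib's `Real.Gamma` is `0`,
so that the corresponding coefficient is `0`, in agreement with the usual convention `1/Γ = 0`. -/
def besselJ (ν t : ℝ) : ℝ :=
  (t / 2) ^ ν *
    ∑' m : ℕ, (-1 : ℝ) ^ m / ((m.factorial : ℝ) * Real.Gamma ((m : ℝ) + ν + 1)) * (t / 2) ^ (2 * m)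

/-- The quotient `(J_μ(t) cos(μπ) - J_{-μ}(t)) / sin(μπ)`, meaningful for non-integral `μ`. -/
def besselYQuotient (μ t : ℝ) : ℝ :=
  (besselJ μ t * Real.cos (μ * π) - besselJ (-μ) t) / Real.sin (μ * π)

open Classical in
/-- The Bessel function of the second kind `Y_ν(t)` of real order `ν`, for `t > 0`: the quotient
`(J_ν(t) cos(νπ) - J_{-ν}(t)) / sin(νπ)` if `ν` is not an integer, and the limit of this quotient as
the order tends to `ν` if `ν` is an integer. -/
def besselY (ν t : ℝ) : ℝ :=
  if ∃ n : ℤ, ν = (n : ℝ) then limUnder (𝓝[≠] ν) (fun μ : ℝ => besselYQuotient μ t)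
  else besselYQuotient ν t

/-- `u_ν(x, y) = x^{1/2} (J_ν(y) Y_ν(xy) - J_ν(xy) Y_ν(y))`. -/
def crossU (ν x y : ℝ) : ℝ :=
  x ^ ((1 : ℝ) / 2) * (besselJ ν y * besselY ν (x * y) - besselJ ν (x * y) * besselY ν y)

/-- `U_ν(ρ, t) = J_ν(ρt) Y_ν(ρb) - J_ν(ρb) Y_ν(ρt)`. -/
def cylinderU (ν b ρ t : ℝ) : ℝ :=
  besselJ ν (ρ * t) * besselY ν (ρ * b) - besselJ ν (ρ * b) * besselY ν (ρ * t)

/-- `y` is the `k`-th positive zero of `f` (`k = 1, 2, …`): it is a positive zero, and exactly `k`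
zeros of `f` lie in `(0, y]`. -/
def IsNthPosZero (f : ℝ → ℝ) (k : ℕ) (y : ℝ) : Prop :=
  0 < y ∧ f y = 0 ∧ {t : ℝ | 0 < t ∧ t ≤ y ∧ f t = 0}.encard = (k : ℕ∞)

theorem IsNthPosZero.unique {f : ℝ → ℝ} {k : ℕ} {y z : ℝ}
    (hy : IsNthPosZero f k y) (hz : IsNthPosZero f k z) : y = z := by
  have key : ∀ {a b : ℝ}, IsNthPosZero f k a → IsNthPosZero f k b → ¬ a < b := by
    intro a b ha hb hab
    have hfin : {t : ℝ | 0 < t ∧ t ≤ a ∧ f t = 0}.Finite :=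
      Set.finite_of_encard_eq_coe ha.2.2
    have hss : {t : ℝ | 0 < t ∧ t ≤ a ∧ f t = 0} ⊂ {t : ℝ | 0 < t ∧ t ≤ b ∧ f t = 0} := by
      refine ⟨fun t ht => ⟨ht.1, ht.2.1.trans hab.le, ht.2.2⟩, fun h => ?_⟩
      exact absurd (h ⟨hb.1, le_rfl, hb.2.1⟩).2.1 (not_le.mpr hab)
    have hlt := hfin.encard_lt_encard hss
    rw [ha.2.2, hb.2.2] at hlt
    exact lt_irrefl _ hlt
  exact le_antisymm (not_lt.mp (key hz hy)) (not_lt.mp (key hy hz))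

open Classical in
/-- The `k`-th positive zero of `f` (with the default value `0` if there is none). -/
def nthPosZero (f : ℝ → ℝ) (k : ℕ) : ℝ :=
  if h : ∃ y : ℝ, IsNthPosZero f k y then h.choose else 0

/-- The zero curve `y_{ν,k}`: `y_{ν,k}(x)` is the `k`-th positive zero of `y ↦ u_ν(x, y)`. -/
def zeroCurve (ν : ℝ) (k : ℕ) (x : ℝ) : ℝ := nthPosZero (fun y => crossU ν x y) k

/-- `ρ_{ν,m}` (for given `b`): the `m`-th positive zero of `ρ ↦ U_ν(ρ, 1)`. -/
def rhoZero (ν b : ℝ) (m : ℕ) : ℝ := nthPosZero (fun ρ => cylinderU ν b ρ 1) m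

end

/-! For `c = ν² - 1/4 ≥ 0` the functions `√t J_ν(t)` and `√t Y_ν(t)` solve
`u'' + (1 - c / t²) u = 0` on `(0, ∞)`. The cross product `J_ν(y) Y_ν(z) - J_ν(z) Y_ν(y)` depends,
up to a constant, only on the solution space, so any other basis may be used to compute it. Whenever
`p > 0` satisfies `2 p p'' - p'² + 4 (1 - c / t²) p² = 4`, the functions `√p cos θ` and `√p sin θ`
with `θ' = 1 / p` form a basis, and the cross product is a nonvanishing multiple of
`sin (θ(z) - θ(y))` (`kernel_eq`). The zeros of `y ↦ u_ν(x, y)` are therefore the solutions of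
`θ(xy) - θ(y) = k π`, and everything follows if `p` is at least `1`, nonincreasing and convex.

Such a `p` (it is `π t (J_ν² + Y_ν²) / 2`, but this is not needed) is written down directly as
`p(t) = 1 + ∫₀^∞ exp (-ts) Q'(s) ds` (`amp`), where `Q` is the solution of
`(s (1 + s²/4) Q')' = c s Q`, `Q(0) = 1`, given by its Picard series (`legendreQ`). Since `Q' ≥ 0`,
the three properties of `p` are evident. The equation for `Q` turns into a third-order linear equation
for `p` (`hasDerivAt_amp''`), whose first integral is found at infinity (`amp_first_integral`).

For non-integral `ν` the constant in the cross product comes from the Wronskian of `√t J_ν` and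
`√t J_{-ν}` at `t → 0` and the reflection formula (`wronskian_sqrtJ`). For integral `ν`, `Y_ν` is a
limit in the order; it exists because `1 / Γ` is entire, and the cross product formula passes to the
limit since `Q`, and hence `p` and `θ`, are continuous in `c` (`kernel_bessel`).

With `φ = 1 / p` nondecreasing and at most `1`, the difference `θ(xy) - θ(y)` increases strictly from
`0` to `∞` in `y` and increases in `x`: hence the zero curves exist and decrease. Subtracting the
equations for `k` and `k + 1` gives `π < θ(x y_{k+1}) - θ(x y_k) ≤ x (y_{k+1} - y_k)`, a spacing
larger than `π / x`. For convexity the curve is described by its inverse `y ↦ z(y) / y`, where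
`θ(z(y)) = θ(y) + k π`, so that `z' = p(z) / p(y)`; its second derivative is
`p(z) (p'(z) - p'(y)) / (y p(y)²) + 2 (z / y - p(z) / p(y)) / y²`, which is nonnegative because `p`
is convex and nonincreasing and `z > y` (`convexOn_advance_div`). -/

namespace BesselCross

open MeasureTheory

/-! ### Laplace transforms of functions of subexponential growth -/

/-- A continuous function which on `[0, ∞)` is `O(exp (ε s))` for every `ε > 0`. -/
def SubExp (f : ℝ → ℝ) : Prop :=
  Continuous f ∧ ∀ ε > 0, ∃ M, ∀ s, 0 ≤ s → |f s| ≤ M * exp (ε * s)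

/-- The Laplace transform `∫₀^∞ exp (-ts) f(s) ds`. -/
noncomputable def laplace (f : ℝ → ℝ) (t : ℝ) : ℝ := ∫ s in Ioi 0, exp (-(t * s)) * f s

theorem SubExp.id_mul {f : ℝ → ℝ} (hf : SubExp f) : SubExp (fun s => s * f s) := by
  refine ⟨continuous_id.mul hf.1, fun ε hε => ?_⟩
  obtain ⟨M, hM⟩ := hf.2 (ε / 2) (by positivity)
  refine ⟨2 / ε * M, fun s hs => ?_⟩
  have h1 : s ≤ 2 / ε * exp (ε / 2 * s) := by
    have := add_one_le_exp (ε / 2 * s)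
    calc s = 2 / ε * (ε / 2 * s) := by field_simp
      _ ≤ _ := by gcongr; linarith
  rw [abs_mul, abs_of_nonneg hs]
  calc s * |f s| ≤ (2 / ε * exp (ε / 2 * s)) * (M * exp (ε / 2 * s)) :=
        mul_le_mul h1 (hM s hs) (abs_nonneg _) (by positivity)
    _ = 2 / ε * M * (exp (ε / 2 * s) * exp (ε / 2 * s)) := by ring
    _ = _ := by rw [← exp_add]; ring_nf

theorem SubExp.const_mul {f : ℝ → ℝ} (hf : SubExp f) (a : ℝ) : SubExp (fun s => a * f s) := by
  refine ⟨continuous_const.mul hf.1, fun ε hε => ?_⟩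
  obtain ⟨M, hM⟩ := hf.2 ε hε
  refine ⟨|a| * M, fun s hs => ?_⟩
  rw [abs_mul, mul_assoc]
  exact mul_le_mul_of_nonneg_left (hM s hs) (abs_nonneg _)

theorem SubExp.mono {f g : ℝ → ℝ} (hf : SubExp f) (hg : Continuous g)
    (h : ∀ s, 0 ≤ s → |g s| ≤ |f s|) : SubExp g := by
  refine ⟨hg, fun ε hε => ?_⟩
  obtain ⟨M, hM⟩ := hf.2 ε hε
  exact ⟨M, fun s hs => (h s hs).trans (hM s hs)⟩

theorem SubExp.exists_bound {f : ℝ → ℝ} (hf : SubExp f) {a t : ℝ} (hat : a < t) :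
    ∃ M, ∀ s, 0 ≤ s → |exp (-(t * s)) * f s| ≤ M * exp (-a * s) := by
  obtain ⟨M, hM⟩ := hf.2 (t - a) (by linarith)
  refine ⟨M, fun s hs => ?_⟩
  rw [abs_mul, abs_of_pos (exp_pos _)]
  calc exp (-(t * s)) * |f s| ≤ exp (-(t * s)) * (M * exp ((t - a) * s)) := by
        gcongr; exact hM s hs
    _ = M * (exp (-(t * s)) * exp ((t - a) * s)) := by ring
    _ = _ := by rw [← exp_add]; ring_nf

theorem SubExp.integrableOn {f : ℝ → ℝ} (hf : SubExp f) {t : ℝ} (ht : 0 < t) :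
    IntegrableOn (fun s => exp (-(t * s)) * f s) (Ioi 0) := by
  obtain ⟨M, hM⟩ := hf.exists_bound (half_lt_self ht)
  have h := (exp_neg_integrableOn_Ioi 0 (half_pos ht)).const_mul M
  refine Integrable.mono' h ?_ ?_
  · exact ((by fun_prop : Continuous fun s : ℝ => exp (-(t * s))).mul hf.1).aestronglyMeasurable
  · refine (ae_restrict_iff' measurableSet_Ioi).2 (ae_of_all _ fun s hs => ?_)
    exact hM s (le_of_lt hs)

theorem hasDerivAt_laplace {f : ℝ → ℝ} (hf : SubExp f) {t : ℝ} (ht : 0 < t) :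
    HasDerivAt (laplace f) (-laplace (fun s => s * f s) t) t := by
  have hcont : ∀ t : ℝ, Continuous fun s : ℝ => exp (-(t * s)) := fun t => by fun_prop
  have ht2 : 0 < t / 2 := half_pos ht
  have key := hasDerivAt_integral_of_dominated_loc_of_deriv_le (𝕜 := ℝ)
    (μ := volume.restrict (Ioi (0 : ℝ))) (F := fun t s => exp (-(t * s)) * f s)
    (F' := fun t s => -(exp (-(t * s)) * (s * f s))) (x₀ := t) (s := Ioi (t / 2))
    (bound := fun s => |exp (-(t / 2 * s)) * (s * f s)|)
    (Ioi_mem_nhds (half_lt_self ht))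
    (Eventually.of_forall fun x => ((hcont x).mul hf.1).aestronglyMeasurable)
    (hf.integrableOn ht)
    (((hcont t).mul hf.id_mul.1).neg.aestronglyMeasurable)
    ?_ ((hf.id_mul.integrableOn ht2).abs) ?_
  · have h := key.2
    rw [integral_neg] at h
    exact h
  · refine (ae_restrict_iff' measurableSet_Ioi).2 (ae_of_all _ fun s hs x hx => ?_)
    rw [norm_neg, Real.norm_eq_abs, abs_mul, abs_mul (exp _), abs_of_pos (exp_pos _),
      abs_of_pos (exp_pos _)]
    have hs' : (0 : ℝ) < s := hs
    have hx' : t / 2 < x := hx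
    gcongr
  · refine ae_of_all _ fun s x _ => ?_
    have h1 : HasDerivAt (fun x : ℝ => -(x * s)) (-s) x := 
      (((hasDerivAt_id x).mul_const s).fun_neg).congr_deriv (by simp)
    exact (h1.exp.mul_const (f s)).congr_deriv (by ring)

theorem tendsto_laplace {f : ℝ → ℝ} (hf : SubExp f) :
    Tendsto (laplace f) atTop (𝓝 0) := by
  have h0 : ∫ _ in Ioi (0 : ℝ), (0 : ℝ) = 0 := by simp
  rw [← h0]
  refine tendsto_integral_filter_of_dominated_convergence
    (fun s => |exp (-(1 * s)) * f s|) ?_ ?_ (hf.integrableOn one_pos).abs ?_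
  · exact Eventually.of_forall fun x =>
      ((by fun_prop : Continuous fun s : ℝ => exp (-(x * s))).mul hf.1).aestronglyMeasurable
  · filter_upwards [eventually_ge_atTop 1] with x hx
    refine (ae_restrict_iff' measurableSet_Ioi).2 (ae_of_all _ fun s hs => ?_)
    have hs' : (0 : ℝ) < s := hs
    rw [Real.norm_eq_abs, abs_mul, abs_mul, abs_of_pos (exp_pos _), abs_of_pos (exp_pos _)]
    gcongr
  · refine (ae_restrict_iff' measurableSet_Ioi).2 (ae_of_all _ fun s hs => ?_)
    have hs' : (0 : ℝ) < s := hs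
    have h1 : Tendsto (fun x : ℝ => exp (-(x * s))) atTop (𝓝 0) :=
      tendsto_exp_neg_atTop_nhds_zero.comp (tendsto_id.atTop_mul_const hs')
    simpa using h1.mul_const (f s)

theorem laplace_nonneg {f : ℝ → ℝ} (hf : ∀ s, 0 ≤ s → 0 ≤ f s) (t : ℝ) : 0 ≤ laplace f t :=
  setIntegral_nonneg measurableSet_Ioi fun s hs =>
    mul_nonneg (exp_pos _).le (hf s (le_of_lt hs))

theorem laplace_const_mul (f : ℝ → ℝ) (a t : ℝ) :
    laplace (fun s => a * f s) t = a * laplace f t := by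
  unfold laplace
  rw [← integral_const_mul]
  congr 1; ext s; ring

theorem laplace_add {f g : ℝ → ℝ} (hf : SubExp f) (hg : SubExp g) {t : ℝ} (ht : 0 < t) :
    laplace (fun s => f s + g s) t = laplace f t + laplace g t := by
  unfold laplace
  rw [← integral_add (hf.integrableOn ht) (hg.integrableOn ht)]
  congr 1; ext s; ring

/-- The Laplace transform of a derivative (integration by parts). -/
theorem laplace_deriv {f f' : ℝ → ℝ} (hf : SubExp f) (hf' : SubExp f')
    (h : ∀ s, HasDerivAt f (f' s) s) {t : ℝ} (ht : 0 < t) :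
    laplace f' t = t * laplace f t - f 0 := by
  have hd : ∀ s, HasDerivAt (fun s => exp (-(t * s)) * f s)
      (exp (-(t * s)) * f' s - t * (exp (-(t * s)) * f s)) s := fun s => by
    have h1 : HasDerivAt (fun s : ℝ => -(t * s)) (-t) s := 
      (((hasDerivAt_id s).const_mul t).fun_neg).congr_deriv (by simp)
    exact (h1.exp.mul (h s)).congr_deriv (by ring)
  have hlim : Tendsto (fun s => exp (-(t * s)) * f s) atTop (𝓝 0) := by
    obtain ⟨M, hM⟩ := hf.exists_bound (half_lt_self ht)
    have h2 : Tendsto (fun s : ℝ => M * exp (-(t / 2) * s)) atTop (𝓝 0) := by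
      have := (tendsto_exp_neg_atTop_nhds_zero.comp
        (tendsto_id.const_mul_atTop (half_pos ht))).const_mul M
      simpa [Function.comp_def] using this
    refine squeeze_zero_norm' ?_ h2
    filter_upwards [eventually_ge_atTop 0] with s hs using hM s hs
  have hi1 := hf'.integrableOn ht
  have hi2 := (hf.integrableOn ht).const_mul t
  have key := integral_Ioi_of_hasDerivAt_of_tendsto
    (hd 0).continuousAt.continuousWithinAt (fun s _ => hd s) (hi1.sub hi2) hlim
  rw [integral_sub hi1 hi2, integral_const_mul] at key
  simp only [mul_zero, neg_zero, exp_zero, one_mul, zero_sub] at key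
  unfold laplace
  linarith

/-! ### The spectral density and its Picard series -/

/-- The weighted mean `∫₀¹ τ h(sτ) dτ`, which is `s⁻² ∫₀ˢ σ h(σ) dσ` for `s ≠ 0`. -/
noncomputable def wmean (h : ℝ → ℝ) (s : ℝ) : ℝ := ∫ τ in (0 : ℝ)..1, τ * h (s * τ)

theorem sq_mul_wmean (h : ℝ → ℝ) (s : ℝ) :
    s ^ 2 * wmean h s = ∫ σ in (0 : ℝ)..s, σ * h σ := by
  have := intervalIntegral.mul_integral_comp_mul_left (a := 0) (b := 1)
    (f := fun σ => σ * h σ) s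
  rw [mul_zero, mul_one] at this
  rw [← this, wmean, sq, mul_assoc, ← intervalIntegral.integral_const_mul s]
  congr 2; ext τ; ring

theorem continuous_wmean {h : ℝ → ℝ} (hh : Continuous h) : Continuous (wmean h) := by
  refine intervalIntegral.continuous_parametric_intervalIntegral_of_continuous'
    (f := fun s τ => τ * h (s * τ)) ?_ 0 1
  simp only [Function.uncurry_def]
  fun_prop

/-- The Volterra operator whose resolvent solves `(s (1 + s²/4) Q')' = c s Q`. -/
noncomputable def volterra (h : ℝ → ℝ) (s : ℝ) : ℝ :=
  ∫ r in (0 : ℝ)..s, r / (1 + r ^ 2 / 4) * wmean h r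

theorem one_add_sq_pos (s : ℝ) : 0 < 1 + s ^ 2 / 4 := by positivity

theorem continuous_volterra_integrand {h : ℝ → ℝ} (hh : Continuous h) :
    Continuous fun r : ℝ => r / (1 + r ^ 2 / 4) * wmean h r :=
  (continuous_id.div (by fun_prop) fun r => (one_add_sq_pos r).ne').mul (continuous_wmean hh)

theorem hasDerivAt_volterra {h : ℝ → ℝ} (hh : Continuous h) (s : ℝ) :
    HasDerivAt (volterra h) (s / (1 + s ^ 2 / 4) * wmean h s) s :=
  (continuous_volterra_integrand hh).integral_hasStrictDerivAt 0 s |>.hasDerivAt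

theorem continuous_volterra {h : ℝ → ℝ} (hh : Continuous h) : Continuous (volterra h) :=
  continuous_iff_continuousAt.2 fun s => (hasDerivAt_volterra hh s).continuousAt

/-- The iterates `volterraⁿ 1`. -/
noncomputable def picard : ℕ → ℝ → ℝ
  | 0 => fun _ => 1
  | n + 1 => volterra (picard n)

theorem continuous_picard : ∀ n, Continuous (picard n)
  | 0 => continuous_const
  | n + 1 => continuous_volterra (continuous_picard n)

theorem wmean_neg {h : ℝ → ℝ} (hh : ∀ s, h (-s) = h s) (s : ℝ) : wmean h (-s) = wmean h s := by
  simp only [wmean, neg_mul, hh]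

theorem picard_neg (n : ℕ) : ∀ s, picard n (-s) = picard n s := by
  induction n with
  | zero => intro s; rfl
  | succ n ih =>
    intro s
    have := intervalIntegral.integral_comp_neg (a := 0) (b := s)
      (fun r : ℝ => r / (1 + r ^ 2 / 4) * wmean (picard n) r)
    simp only [wmean_neg ih, neg_sq, neg_zero, neg_div, neg_mul,
      intervalIntegral.integral_neg] at this
    simp only [picard, volterra]
    rw [intervalIntegral.integral_symm, ← this, neg_neg]

/-- The growth exponent: `legendreQ c s` is at most `exp (c * growth s)` for `c, s ≥ 0`. -/
noncomputable def growth (s : ℝ) : ℝ := log (1 + s ^ 2 / 4)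

theorem growth_nonneg (s : ℝ) : 0 ≤ growth s := log_nonneg (by nlinarith [sq_nonneg s])

theorem growth_mono {r s : ℝ} (h : |r| ≤ |s|) : growth r ≤ growth s :=
  log_le_log (one_add_sq_pos r) (by have := sq_le_sq.2 h; linarith)

theorem hasDerivAt_growth (s : ℝ) : HasDerivAt growth (s / 2 / (1 + s ^ 2 / 4)) s := by
  have h1 : HasDerivAt (fun s : ℝ => 1 + s ^ 2 / 4) (s / 2) s :=
    (((hasDerivAt_pow 2 s).div_const 4).const_add 1).congr_deriv (by norm_num; ring)
  exact h1.log (one_add_sq_pos s).ne'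

theorem continuous_growth : Continuous growth :=
  continuous_iff_continuousAt.2 fun s => (hasDerivAt_growth s).continuousAt

theorem wmean_le {h : ℝ → ℝ} (hh : Continuous h) {s M : ℝ}
    (hM : ∀ τ ∈ Icc (0 : ℝ) 1, h (s * τ) ≤ M) : wmean h s ≤ M / 2 := by
  have h1 : wmean h s ≤ ∫ τ in (0 : ℝ)..1, τ * M := by
    refine intervalIntegral.integral_mono_on zero_le_one
      (Continuous.intervalIntegrable (by fun_prop) _ _)
      (Continuous.intervalIntegrable (by fun_prop) _ _) fun τ hτ => ?_
    exact mul_le_mul_of_nonneg_left (hM τ hτ) hτ.1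
  rw [intervalIntegral.integral_mul_const, integral_id] at h1
  linarith

theorem abs_mul_le_of_mem {s τ : ℝ} (hτ : τ ∈ Icc (0 : ℝ) 1) : |s * τ| ≤ |s| := by
  rw [abs_mul, abs_of_nonneg hτ.1]; exact mul_le_of_le_one_right (abs_nonneg s) hτ.2

theorem wmean_nonneg {h : ℝ → ℝ} {s : ℝ}
    (hM : ∀ τ ∈ Icc (0 : ℝ) 1, 0 ≤ h (s * τ)) : 0 ≤ wmean h s :=
  intervalIntegral.integral_nonneg zero_le_one fun τ hτ => mul_nonneg hτ.1 (hM τ hτ)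

theorem picard_bounds (n : ℕ) : ∀ s, 0 ≤ s →
    0 ≤ picard n s ∧ picard n s ≤ growth s ^ n / n.factorial := by
  induction n with
  | zero => intro s _; simp [picard]
  | succ n ih =>
    intro s hs
    have hc := continuous_volterra_integrand (continuous_picard n)
    constructor
    · refine intervalIntegral.integral_nonneg hs fun r hr => ?_
      exact mul_nonneg (div_nonneg hr.1 (one_add_sq_pos r).le)
        (wmean_nonneg fun τ hτ => (ih _ (mul_nonneg hr.1 hτ.1)).1)
    · have hd : ∀ r, HasDerivAt (fun r => growth r ^ (n + 1) / (n + 1).factorial)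
          (r / (1 + r ^ 2 / 4) * (growth r ^ n / n.factorial / 2)) r := fun r => by
        refine (((hasDerivAt_growth r).fun_pow (n + 1)).div_const _).congr_deriv ?_
        have := (one_add_sq_pos r).ne'
        rw [Nat.factorial_succ]
        push_cast
        field_simp
      have hcont : Continuous fun r : ℝ =>
          r / (1 + r ^ 2 / 4) * (growth r ^ n / n.factorial / 2) :=
        (continuous_id.div (by fun_prop) fun r => (one_add_sq_pos r).ne').mul
          (((continuous_growth.pow n).div_const _).div_const _)
      have hint := intervalIntegral.integral_eq_sub_of_hasDerivAt (a := 0) (b := s)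
        (fun r _ => hd r) (hcont.intervalIntegrable _ _)
      have h0 : growth 0 = 0 := by simp [growth]
      rw [h0, zero_pow (Nat.succ_ne_zero n), zero_div, sub_zero] at hint
      rw [← hint]
      refine intervalIntegral.integral_mono_on hs (hc.intervalIntegrable _ _)
        (hcont.intervalIntegrable _ _) fun r hr => ?_
      refine mul_le_mul_of_nonneg_left ?_ (div_nonneg hr.1 (one_add_sq_pos r).le)
      refine wmean_le (continuous_picard n) fun τ hτ => (ih _ (mul_nonneg hr.1 hτ.1)).2.trans ?_
      have h1 : growth (r * τ) ≤ growth r := growth_mono (abs_mul_le_of_mem hτ)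
      have := growth_nonneg (r * τ)
      gcongr

theorem abs_picard_le (n : ℕ) (s : ℝ) : |picard n s| ≤ growth s ^ n / n.factorial := by
  rcases le_total 0 s with hs | hs
  · rw [abs_of_nonneg (picard_bounds n s hs).1]; exact (picard_bounds n s hs).2
  · have h := picard_bounds n (-s) (by linarith)
    rw [picard_neg] at h
    rw [abs_of_nonneg h.1]
    simpa [growth] using h.2

/-- The solution of `(s (1 + s²/4) Q')' = c s Q`, `Q(0) = 1`; as a function of `1 + s²/2` it is the
Legendre function `P_{ν-1/2}` with `c = ν² - 1/4`. -/
noncomputable def legendreQ (c s : ℝ) : ℝ := ∑' n : ℕ, c ^ n * picard n s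

theorem abs_term_le {c C s r : ℝ} (hc : |c| ≤ C) (hs : |s| ≤ |r|) (n : ℕ) :
    ‖c ^ n * picard n s‖ ≤ (C * growth r) ^ n / n.factorial := by
  rw [norm_mul, norm_pow, Real.norm_eq_abs, Real.norm_eq_abs, mul_pow, mul_div_assoc]
  have h1 := (abs_picard_le n s).trans (by
    have := growth_mono hs
    have := growth_nonneg s
    gcongr : growth s ^ n / n.factorial ≤ growth r ^ n / n.factorial)
  exact mul_le_mul (pow_le_pow_left₀ (abs_nonneg c) hc n) h1 (abs_nonneg _)
    (pow_nonneg ((abs_nonneg c).trans hc) n)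

theorem summable_term (c s : ℝ) : Summable fun n : ℕ => c ^ n * picard n s :=
  (Real.summable_pow_div_factorial (|c| * growth s)).of_norm_bounded
    (abs_term_le le_rfl le_rfl)

theorem continuous_legendreQ (c : ℝ) : Continuous (legendreQ c) := by
  refine continuous_iff_continuousAt.2 fun s => ?_
  have h : ContinuousOn (legendreQ c) (Icc (s - 1) (s + 1)) := by
    refine continuousOn_tsum (fun n => ((continuous_picard n).const_mul _).continuousOn)
      (Real.summable_pow_div_factorial (|c| * growth (|s| + 1))) fun n x hx => ?_
    refine abs_term_le le_rfl ?_ n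
    rw [abs_of_nonneg (by positivity : 0 ≤ |s| + 1)]
    rw [abs_le]
    constructor <;> linarith [hx.1, hx.2, neg_abs_le s, le_abs_self s]
  exact h.continuousAt (Icc_mem_nhds (by linarith) (by linarith))

theorem continuous_legendreQ_param (s : ℝ) : Continuous fun c => legendreQ c s := by
  refine continuous_iff_continuousAt.2 fun c => ?_
  have h : ContinuousOn (fun c => legendreQ c s) (Icc (c - 1) (c + 1)) := by
    refine continuousOn_tsum (fun n => (by fun_prop : Continuous _).continuousOn)
      (Real.summable_pow_div_factorial ((|c| + 1) * growth s)) fun n x hx => ?_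
    refine abs_term_le ?_ le_rfl n
    rw [abs_le]
    constructor <;> linarith [hx.1, hx.2, neg_abs_le c, le_abs_self c]
  exact h.continuousAt (Icc_mem_nhds (by linarith) (by linarith))

theorem integral_tsum_of_le {F : ℕ → ℝ → ℝ} {u : ℕ → ℝ} {a b : ℝ} (hF : ∀ n, Continuous (F n))
    (hu : Summable u) (hle : ∀ n, ∀ x ∈ uIcc a b, ‖F n x‖ ≤ u n) :
    ∫ x in a..b, ∑' n, F n x = ∑' n, ∫ x in a..b, F n x := by
  refine (intervalIntegral.hasSum_integral_of_dominated_convergence (fun n _ => u n)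
    (fun n => (hF n).aestronglyMeasurable)
    (fun n => ae_of_all _ fun x hx => hle n x (uIoc_subset_uIcc hx))
    (ae_of_all _ fun _ _ => hu) (by simp) ?_).tsum_eq.symm
  exact ae_of_all _ fun x hx =>
    (hu.of_norm_bounded fun n => hle n x (uIoc_subset_uIcc hx)).hasSum

theorem wmean_legendreQ (c s : ℝ) :
    wmean (legendreQ c) s = ∑' n : ℕ, c ^ n * wmean (picard n) s := by
  simp only [wmean, legendreQ, ← tsum_mul_left]
  rw [integral_tsum_of_le (u := fun n => (|c| * growth s) ^ n / n.factorial)]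
  · congr 1; ext n
    rw [← intervalIntegral.integral_const_mul]
    congr 1; ext τ; ring
  · intro n
    have := continuous_picard n
    fun_prop
  · exact Real.summable_pow_div_factorial _
  · intro n τ hτ
    rw [uIcc_of_le zero_le_one] at hτ
    have h := abs_term_le (c := c) (s := s * τ) (r := s) le_rfl
      (abs_mul_le_of_mem hτ) n
    rw [norm_mul, Real.norm_eq_abs, abs_of_nonneg hτ.1]
    exact (mul_le_of_le_one_left (norm_nonneg _) hτ.2).trans h

theorem abs_wmean_le {h : ℝ → ℝ} {s M : ℝ} (hM : ∀ τ ∈ Icc (0 : ℝ) 1, |h (s * τ)| ≤ M) :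
    |wmean h s| ≤ M := by
  have := intervalIntegral.norm_integral_le_of_norm_le_const (a := 0) (b := 1)
    (f := fun τ => τ * h (s * τ)) (C := M) (fun τ hτ => by
      rw [uIoc_of_le zero_le_one] at hτ
      rw [norm_mul, Real.norm_eq_abs, abs_of_nonneg hτ.1.le]
      exact (mul_le_of_le_one_left (norm_nonneg _) hτ.2).trans (hM τ ⟨hτ.1.le, hτ.2⟩))
  simpa [wmean] using this

theorem volterra_legendreQ (c s : ℝ) :
    volterra (legendreQ c) s = ∑' n : ℕ, c ^ n * picard (n + 1) s := by
  simp only [volterra, wmean_legendreQ, ← tsum_mul_left]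
  rw [integral_tsum_of_le (u := fun n => |s| * ((|c| * growth s) ^ n / n.factorial))]
  · congr 1; ext n
    simp only [picard, volterra]
    rw [← intervalIntegral.integral_const_mul]
    congr 1; ext τ; ring
  · intro n
    have := (continuous_volterra_integrand (continuous_picard n)).const_mul (c ^ n)
    exact this.congr fun r => by ring
  · exact (Real.summable_pow_div_factorial _).mul_left _
  · intro n r hr
    have hr' : |r| ≤ |s| := by
      rw [mem_uIcc] at hr
      rw [abs_le]
      constructor <;> rcases hr with h | h <;>
        linarith [h.1, h.2, neg_abs_le s, le_abs_self s, abs_nonneg s]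
    have h1 : |c ^ n * wmean (picard n) r| ≤ (|c| * growth s) ^ n / n.factorial := by
      have : c ^ n * wmean (picard n) r = wmean (fun s => c ^ n * picard n s) r := by
        simp only [wmean]
        rw [← intervalIntegral.integral_const_mul]
        congr 1; ext τ; ring
      rw [this]
      exact abs_wmean_le fun τ hτ => abs_term_le le_rfl ((abs_mul_le_of_mem hτ).trans hr') n
    rw [norm_mul, norm_div, Real.norm_eq_abs, Real.norm_eq_abs,
      abs_of_pos (one_add_sq_pos r)]
    refine mul_le_mul ?_ h1 (abs_nonneg _) (abs_nonneg _)
    exact (div_le_self (abs_nonneg r) (by nlinarith [sq_nonneg r])).trans hr'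

/-- The Volterra equation solved by the Picard series. -/
theorem legendreQ_eq (c s : ℝ) : legendreQ c s = 1 + c * volterra (legendreQ c) s := by
  rw [volterra_legendreQ, legendreQ, (summable_term c s).tsum_eq_zero_add, ← tsum_mul_left]
  congr 1
  · simp [picard]
  · congr 1; ext n; ring

/-- The derivative of `legendreQ c`. -/
noncomputable def legendreQ' (c s : ℝ) : ℝ := c * (s / (1 + s ^ 2 / 4) * wmean (legendreQ c) s)

theorem hasDerivAt_legendreQ (c s : ℝ) : HasDerivAt (legendreQ c) (legendreQ' c s) s := by
  have h := ((hasDerivAt_volterra (continuous_legendreQ c) s).const_mul c).const_add 1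
  exact h.congr_of_eventuallyEq (Eventually.of_forall fun s => legendreQ_eq c s)

theorem legendreQ_zero (c : ℝ) : legendreQ c 0 = 1 := by
  rw [legendreQ_eq]; simp [volterra]

theorem legendreQ_nonneg {c s : ℝ} (hc : 0 ≤ c) (hs : 0 ≤ s) : 0 ≤ legendreQ c s :=
  tsum_nonneg fun n => mul_nonneg (pow_nonneg hc n) (picard_bounds n s hs).1

theorem legendreQ_mono_param {c C s : ℝ} (hc : 0 ≤ c) (hC : c ≤ C) (hs : 0 ≤ s) :
    legendreQ c s ≤ legendreQ C s :=
  (summable_term c s).tsum_le_tsum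
    (fun n => mul_le_mul_of_nonneg_right (pow_le_pow_left₀ hc hC n) (picard_bounds n s hs).1)
    (summable_term C s)

theorem legendreQ_le {c s : ℝ} (hc : 0 ≤ c) (hs : 0 ≤ s) :
    legendreQ c s ≤ exp (c * growth s) := by
  have h : HasSum (fun n : ℕ => (c * growth s) ^ n / n.factorial) (exp (c * growth s)) := by
    rw [Real.exp_eq_exp_ℝ]; exact NormedSpace.expSeries_div_hasSum_exp _
  refine (summable_term c s).tsum_le_of_sum_le ?_ |>.trans h.tsum_eq.le
  intro F
  refine (Finset.sum_le_sum fun n _ => ?_).trans (h.summable.sum_le_tsum F fun n _ => ?_)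
  · rw [mul_pow, mul_div_assoc]
    exact mul_le_mul_of_nonneg_left (picard_bounds n s hs).2 (pow_nonneg hc n)
  · have := growth_nonneg s
    positivity

theorem legendreQ'_nonneg {c s : ℝ} (hc : 0 ≤ c) (hs : 0 ≤ s) : 0 ≤ legendreQ' c s :=
  mul_nonneg hc (mul_nonneg (div_nonneg hs (one_add_sq_pos s).le)
    (wmean_nonneg fun _ hτ => legendreQ_nonneg hc (mul_nonneg hs hτ.1)))

theorem continuous_legendreQ' (c : ℝ) : Continuous (legendreQ' c) :=
  (continuous_volterra_integrand (continuous_legendreQ c)).const_mul c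

theorem subExp_exp_growth {c : ℝ} (hc : 0 ≤ c) : SubExp fun s => exp (c * growth s) := by
  refine ⟨continuous_exp.comp (continuous_growth.const_mul c), fun ε hε => ?_⟩
  -- `δ` is chosen so that `2 c δ ≤ ε`
  set δ := ε / (2 * c + 1) with hδ
  have hδ0 : 0 < δ := by positivity
  have h2 : 2 * c * δ ≤ ε := by
    have : (2 * c + 1) * δ = ε := by rw [hδ]; field_simp
    nlinarith
  refine ⟨exp (2 * c * (δ - log δ)), fun s hs => ?_⟩
  have h1 : growth s ≤ 2 * (δ * s + δ - log δ) := by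
    have h3 : growth s ≤ 2 * log (1 + s) := by
      have : 2 * log (1 + s) = log ((1 + s) ^ 2) := by rw [log_pow]; norm_num
      rw [this]
      exact log_le_log (one_add_sq_pos s) (by nlinarith)
    have h4 : log (1 + s) = log (δ * (1 + s)) - log δ := by
      rw [log_mul hδ0.ne' (by linarith)]; ring
    have h5 := log_le_sub_one_of_pos (mul_pos hδ0 (by linarith : 0 < 1 + s))
    linarith
  rw [abs_of_pos (exp_pos _), ← exp_add]
  refine exp_le_exp.2 ?_
  have h6 := mul_le_mul_of_nonneg_left h1 hc
  have h7 := mul_le_mul_of_nonneg_right h2 hs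
  linarith

theorem subExp_legendreQ {c : ℝ} (hc : 0 ≤ c) : SubExp (legendreQ c) :=
  (subExp_exp_growth hc).mono (continuous_legendreQ c) fun s hs => by
    rw [abs_of_nonneg (legendreQ_nonneg hc hs), abs_of_pos (exp_pos _)]
    exact legendreQ_le hc hs

theorem wmean_legendreQ_le {c s : ℝ} (hc : 0 ≤ c) (hs : 0 ≤ s) :
    |wmean (legendreQ c) s| ≤ exp (c * growth s) :=
  abs_wmean_le fun τ hτ => by
    rw [abs_of_nonneg (legendreQ_nonneg hc (mul_nonneg hs hτ.1))]
    refine (legendreQ_le hc (mul_nonneg hs hτ.1)).trans (exp_le_exp.2 ?_)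
    exact mul_le_mul_of_nonneg_left (growth_mono (abs_mul_le_of_mem hτ)) hc

theorem subExp_wmean {c : ℝ} (hc : 0 ≤ c) : SubExp (wmean (legendreQ c)) :=
  (subExp_exp_growth hc).mono (continuous_wmean (continuous_legendreQ c)) fun s hs => by
    rw [abs_of_pos (exp_pos _)]
    exact wmean_legendreQ_le hc hs

theorem subExp_legendreQ' {c : ℝ} (hc : 0 ≤ c) : SubExp (legendreQ' c) :=
  ((subExp_wmean hc).id_mul.const_mul c).mono (continuous_legendreQ' c) fun s hs => by
    simp only [legendreQ', abs_mul, abs_div, abs_of_pos (one_add_sq_pos s)]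
    gcongr
    exact div_le_self (abs_nonneg s) (by nlinarith [sq_nonneg s])

/-- For `Q = legendreQ c`, the function `s² wmean Q` is an antiderivative of `s Q`; as `c` times it is
`s (1 + s²/4) Q'`, this is the second-order equation for `Q`. -/
theorem hasDerivAt_sq_mul_wmean (c s : ℝ) :
    HasDerivAt (fun s => s * (s * wmean (legendreQ c) s)) (s * legendreQ c s) s := by
  have h : Continuous fun σ => σ * legendreQ c σ := continuous_id.mul (continuous_legendreQ c)
  refine (h.integral_hasStrictDerivAt 0 s).hasDerivAt.congr_of_eventuallyEq
    (Eventually.of_forall fun s => ?_)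
  simp only []
  rw [← sq_mul_wmean]; ring

/-! ### The squared amplitude -/

/-- The squared amplitude `p`, namely `π t (J_ν² + Y_ν²) / 2` for `c = ν² - 1/4`, written as
`1` plus the Laplace transform of the nonnegative function `legendreQ' c`. -/
noncomputable def amp (c t : ℝ) : ℝ := 1 + laplace (legendreQ' c) t

/-- The first derivative of `amp c`. -/
noncomputable def amp' (c t : ℝ) : ℝ := -laplace (fun s => s * legendreQ' c s) t

/-- The second derivative of `amp c`. -/
noncomputable def amp'' (c t : ℝ) : ℝ := laplace (fun s => s * (s * legendreQ' c s)) t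

section
variable {c t : ℝ}

theorem hasDerivAt_amp (hc : 0 ≤ c) (ht : 0 < t) : HasDerivAt (amp c) (amp' c t) t :=
  (hasDerivAt_laplace (subExp_legendreQ' hc) ht).const_add 1

theorem hasDerivAt_amp' (hc : 0 ≤ c) (ht : 0 < t) : HasDerivAt (amp' c) (amp'' c t) t :=
  (hasDerivAt_laplace (subExp_legendreQ' hc).id_mul ht).fun_neg.congr_deriv (neg_neg _)

theorem one_le_amp (hc : 0 ≤ c) : 1 ≤ amp c t :=
  le_add_of_nonneg_right (laplace_nonneg (fun _ hs => legendreQ'_nonneg hc hs) t)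

theorem amp_pos (hc : 0 ≤ c) : 0 < amp c t := one_pos.trans_le (one_le_amp hc)

theorem amp'_nonpos (hc : 0 ≤ c) : amp' c t ≤ 0 :=
  neg_nonpos.2 (laplace_nonneg (fun _ hs => mul_nonneg hs (legendreQ'_nonneg hc hs)) t)

theorem amp''_nonneg (hc : 0 ≤ c) : 0 ≤ amp'' c t :=
  laplace_nonneg (fun _ hs => mul_nonneg hs (mul_nonneg hs (legendreQ'_nonneg hc hs))) t

theorem amp_eq_mul_laplace (hc : 0 ≤ c) (ht : 0 < t) : amp c t = t * laplace (legendreQ c) t := by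
  have := laplace_deriv (subExp_legendreQ hc) (subExp_legendreQ' hc) (hasDerivAt_legendreQ c) ht
  rw [amp, this, legendreQ_zero]; ring

/-- The third-order linear equation satisfied by products of two solutions of
`u'' + (1 - c / t²) u = 0`. -/
theorem hasDerivAt_amp'' (hc : 0 ≤ c) (ht : 0 < t) :
    HasDerivAt (amp'' c)
      (-4 * amp' c t + 4 * c * (amp' c t / t ^ 2 - amp c t / t ^ 3)) t := by
  have hQ := subExp_legendreQ hc
  have hQ' := subExp_legendreQ' hc
  have hW : SubExp fun s => s * (s * wmean (legendreQ c) s) := (subExp_wmean hc).id_mul.id_mul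
  refine (hasDerivAt_laplace hQ'.id_mul.id_mul ht).congr_deriv ?_
  -- Laplace transform of `(4 s + s³) Q' = 4 c s² wmean Q`
  have h1 : laplace (fun s => s * (s * (s * legendreQ' c s))) t
      = 4 * c * laplace (fun s => s * (s * wmean (legendreQ c) s)) t
        + 4 * amp' c t := by
    rw [amp', mul_neg, ← laplace_const_mul, ← laplace_const_mul, eq_add_neg_iff_add_eq,
      ← laplace_add hQ'.id_mul.id_mul.id_mul (hQ'.id_mul.const_mul 4) ht]
    congr 1; ext s
    have := (one_add_sq_pos s).ne'
    rw [legendreQ']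
    field_simp
    ring
  have h2 := laplace_deriv hW hQ.id_mul (hasDerivAt_sq_mul_wmean c) ht
  -- differentiating `p = t L(Q)` expresses `L(s Q)` through `p` and `p'`
  have h3 : amp' c t = 1 * laplace (legendreQ c) t
      + t * -laplace (fun s => s * legendreQ c s) t := by
    refine (hasDerivAt_amp hc ht).unique ?_
    refine ((hasDerivAt_id t).mul (hasDerivAt_laplace hQ ht)).congr_of_eventuallyEq ?_
    filter_upwards [Ioi_mem_nhds ht] with r hr using amp_eq_mul_laplace hc hr
  have h4 := amp_eq_mul_laplace hc ht
  rw [h1]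
  have h5 : laplace (legendreQ c) t = amp c t / t := by rw [h4]; field_simp
  have h6 : laplace (fun s => s * legendreQ c s) t = (amp c t / t - amp' c t) / t := by
    rw [h3, h5]; field_simp; ring
  have h7 : laplace (fun s => s * (s * wmean (legendreQ c) s)) t
      = (amp c t / t - amp' c t) / t / t := by
    rw [← h6, h2]; field_simp; ring
  rw [h7]; field_simp; ring

/-- The first integral of the third-order equation; its value is found at infinity. -/
theorem amp_first_integral (hc : 0 ≤ c) (ht : 0 < t) :
    2 * amp c t * amp'' c t - amp' c t ^ 2 + 4 * (1 - c / t ^ 2) * amp c t ^ 2 = 4 := by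
  set E : ℝ → ℝ := fun t =>
    2 * amp c t * amp'' c t - amp' c t ^ 2 + 4 * (1 - c / t ^ 2) * amp c t ^ 2 with hE
  have hd : ∀ r ∈ Ioi (0 : ℝ), HasDerivAt E 0 r := by
    intro r hr
    have hr' : (0 : ℝ) < r := hr
    have ha := hasDerivAt_amp hc hr'
    have hb := hasDerivAt_amp' hc hr'
    have hq : HasDerivAt (fun r : ℝ => 4 * (1 - c / r ^ 2)) (8 * c / r ^ 3) r := by
      refine ((((hasDerivAt_const r c).fun_div (hasDerivAt_pow 2 r) (by positivity)).const_sub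
        1).const_mul 4).congr_deriv ?_
      field_simp; norm_num; ring
    refine ((((ha.const_mul 2).mul (hasDerivAt_amp'' hc hr')).sub (hb.pow 2)).add
      (hq.mul (ha.pow 2))).congr_deriv ?_
    simp only [Pi.pow_apply]
    field_simp; ring
  have hconst : ∀ r ∈ Ioi (0 : ℝ), E r = E t := fun r hr =>
    (convex_Ioi (0 : ℝ)).is_const_of_fderivWithin_eq_zero (𝕜 := ℝ)
      (fun x hx => (hd x hx).differentiableAt.differentiableWithinAt)
      (fun x hx => by
        rw [fderivWithin_of_isOpen isOpen_Ioi hx]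
        ext; simp [(hd x hx).deriv]) hr ht
  have hlim : Tendsto E atTop (𝓝 (2 * (1 + 0) * 0 - (-0) ^ 2 + 4 * (1 - 0) * (1 + 0) ^ 2)) := by
    have h1 := (tendsto_laplace (subExp_legendreQ' hc)).const_add 1
    have h2 := (tendsto_laplace (subExp_legendreQ' hc).id_mul).neg
    have h3 := tendsto_laplace (subExp_legendreQ' hc).id_mul.id_mul
    have h4 : Tendsto (fun t : ℝ => c / t ^ 2) atTop (𝓝 0) :=
      tendsto_const_nhds.div_atTop (tendsto_pow_atTop two_ne_zero)
    exact (((h1.const_mul 2).mul h3).sub (h2.pow 2)).add (((h4.const_sub 1).const_mul 4).mul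
      (h1.pow 2))
  have hlim' : Tendsto E atTop (𝓝 (E t)) := by
    refine tendsto_const_nhds.congr' ?_
    filter_upwards [eventually_gt_atTop 0] with r hr using (hconst r hr).symm
  have := tendsto_nhds_unique hlim' hlim
  norm_num at this
  exact this

theorem continuousOn_amp (hc : 0 ≤ c) : ContinuousOn (amp c) (Ioi 0) := fun _ ht =>
  (hasDerivAt_amp hc ht).continuousAt.continuousWithinAt

theorem antitoneOn_amp (hc : 0 ≤ c) : AntitoneOn (amp c) (Ioi 0) := by
  refine antitoneOn_of_deriv_nonpos (convex_Ioi 0) (continuousOn_amp hc) ?_ ?_ <;>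
    rw [interior_Ioi] <;> intro t ht
  · exact (hasDerivAt_amp hc ht).differentiableAt.differentiableWithinAt
  · rw [(hasDerivAt_amp hc ht).deriv]; exact amp'_nonpos hc

theorem monotoneOn_amp' (hc : 0 ≤ c) : MonotoneOn (amp' c) (Ioi 0) := by
  refine monotoneOn_of_deriv_nonneg (convex_Ioi 0) (fun t ht =>
    (hasDerivAt_amp' hc ht).continuousAt.continuousWithinAt) ?_ ?_ <;>
    rw [interior_Ioi] <;> intro t ht
  · exact (hasDerivAt_amp' hc ht).differentiableAt.differentiableWithinAt
  · rw [(hasDerivAt_amp' hc ht).deriv]; exact amp''_nonneg hc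

/-- Continuity of the amplitude in the parameter `c`. -/
theorem tendsto_amp_param {ι : Type*} {l : Filter ι} [l.IsCountablyGenerated] {γ : ι → ℝ}
    (hc : 0 ≤ c) (hγ : Tendsto γ l (𝓝 c)) (hγ0 : ∀ᶠ i in l, 0 ≤ γ i) (ht : 0 < t) :
    Tendsto (fun i => amp (γ i) t) l (𝓝 (amp c t)) := by
  have h : Tendsto (fun i => laplace (legendreQ (γ i)) t) l (𝓝 (laplace (legendreQ c) t)) := by
    refine tendsto_integral_filter_of_dominated_convergence
      (fun s => exp (-(t * s)) * legendreQ (c + 1) s) ?_ ?_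
      ((subExp_legendreQ (by linarith)).integrableOn ht) ?_
    · exact Eventually.of_forall fun i => ((by fun_prop : Continuous fun s : ℝ =>
        exp (-(t * s))).mul (continuous_legendreQ _)).aestronglyMeasurable
    · filter_upwards [hγ0, hγ.eventually (ge_mem_nhds (lt_add_one c))] with i h0 h1
      refine (ae_restrict_iff' measurableSet_Ioi).2 (ae_of_all _ fun s hs => ?_)
      have hs' : (0 : ℝ) ≤ s := le_of_lt hs
      rw [Real.norm_eq_abs, abs_mul, abs_of_pos (exp_pos _),
        abs_of_nonneg (legendreQ_nonneg h0 hs')]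
      exact mul_le_mul_of_nonneg_left (legendreQ_mono_param h0 h1 hs') (exp_pos _).le
    · exact ae_of_all _ fun s =>
        (((continuous_legendreQ_param s).tendsto c).comp hγ).const_mul _
  rw [amp_eq_mul_laplace hc ht]
  refine (h.const_mul t).congr' ?_
  filter_upwards [hγ0] with i hi using (amp_eq_mul_laplace hi ht).symm

/-! ### The phase -/

/-- The phase difference `θ(z) - θ(y)`, where `θ' = 1 / amp c`. -/
noncomputable def phase (c y z : ℝ) : ℝ := ∫ t in y..z, (amp c t)⁻¹

theorem uIcc_subset_Ioi {y z : ℝ} (hy : 0 < y) (hz : 0 < z) : uIcc y z ⊆ Ioi 0 :=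
  fun _ ht => (lt_min hy hz).trans_le ht.1

theorem continuousOn_inv_amp (hc : 0 ≤ c) : ContinuousOn (fun t => (amp c t)⁻¹) (Ioi 0) :=
  (continuousOn_amp hc).inv₀ fun _ _ => (amp_pos hc).ne'

theorem intervalIntegrable_inv_amp (hc : 0 ≤ c) {y z : ℝ} (hy : 0 < y) (hz : 0 < z) :
    IntervalIntegrable (fun t => (amp c t)⁻¹) volume y z :=
  ((continuousOn_inv_amp hc).mono (uIcc_subset_Ioi hy hz)).intervalIntegrable

theorem hasStrictDerivAt_phase (hc : 0 ≤ c) {y z : ℝ} (hy : 0 < y) (hz : 0 < z) :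
    HasStrictDerivAt (phase c y) (amp c z)⁻¹ z :=
  intervalIntegral.integral_hasStrictDerivAt_right (intervalIntegrable_inv_amp hc hy hz)
    ((continuousOn_inv_amp hc).stronglyMeasurableAtFilter isOpen_Ioi z hz)
    ((continuousOn_inv_amp hc).continuousAt (Ioi_mem_nhds hz))

theorem hasDerivAt_phase (hc : 0 ≤ c) {y z : ℝ} (hy : 0 < y) (hz : 0 < z) :
    HasDerivAt (phase c y) (amp c z)⁻¹ z := (hasStrictDerivAt_phase hc hy hz).hasDerivAt

theorem phase_add (hc : 0 ≤ c) {x y z : ℝ} (hx : 0 < x) (hy : 0 < y) (hz : 0 < z) :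
    phase c x y + phase c y z = phase c x z :=
  intervalIntegral.integral_add_adjacent_intervals (intervalIntegrable_inv_amp hc hx hy)
    (intervalIntegrable_inv_amp hc hy hz)

theorem tendsto_phase_param {ι : Type*} {l : Filter ι} [l.IsCountablyGenerated] {γ : ι → ℝ}
    (hc : 0 ≤ c) (hγ : Tendsto γ l (𝓝 c)) (hγ0 : ∀ᶠ i in l, 0 ≤ γ i) {y z : ℝ} (hy : 0 < y)
    (hz : 0 < z) : Tendsto (fun i => phase (γ i) y z) l (𝓝 (phase c y z)) := by
  refine intervalIntegral.tendsto_integral_filter_of_dominated_convergence (fun _ => 1) ?_ ?_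
    (by simp) ?_
  · filter_upwards [hγ0] with i hi
    exact (intervalIntegrable_inv_amp hi hy hz).def'.aestronglyMeasurable
  · filter_upwards [hγ0] with i hi
    refine ae_of_all _ fun t _ => ?_
    rw [Real.norm_eq_abs, abs_of_pos (inv_pos.2 (amp_pos hi))]
    exact inv_le_one_of_one_le₀ (one_le_amp hi)
  · exact ae_of_all _ fun t ht => (tendsto_amp_param hc hγ hγ0
      (uIcc_subset_Ioi hy hz (uIoc_subset_uIcc ht))).inv₀ (amp_pos hc).ne'

/-- The Wronskian of two solutions of `u'' + q u = 0` on `(0, ∞)` is constant. -/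
theorem wronskian_const {f f' g g' q : ℝ → ℝ}
    (hf : ∀ t, 0 < t → HasDerivAt f (f' t) t) (hf' : ∀ t, 0 < t → HasDerivAt f' (-(q t * f t)) t)
    (hg : ∀ t, 0 < t → HasDerivAt g (g' t) t) (hg' : ∀ t, 0 < t → HasDerivAt g' (-(q t * g t)) t)
    {y z : ℝ} (hy : 0 < y) (hz : 0 < z) :
    f y * g' y - f' y * g y = f z * g' z - f' z * g z := by
  have hd : ∀ r ∈ Ioi (0 : ℝ), HasDerivAt (fun t => f t * g' t - f' t * g t) 0 r := fun r hr =>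
    (((hf r hr).mul (hg' r hr)).sub ((hf' r hr).mul (hg r hr))).congr_deriv (by ring)
  exact (convex_Ioi (0 : ℝ)).is_const_of_fderivWithin_eq_zero (𝕜 := ℝ)
    (fun x hx => (hd x hx).differentiableAt.differentiableWithinAt)
    (fun x hx => by
      rw [fderivWithin_of_isOpen isOpen_Ioi hx]
      ext; simp [(hd x hx).deriv]) hy hz

/-- The amplitude-phase form of the antisymmetric kernel of two solutions of
`u'' + (1 - c / t²) u = 0` with Wronskian `W`. -/
theorem kernel_eq {f f' g g' : ℝ → ℝ} {W : ℝ} (hc : 0 ≤ c)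
    (hf : ∀ t, 0 < t → HasDerivAt f (f' t) t)
    (hf' : ∀ t, 0 < t → HasDerivAt f' (-((1 - c / t ^ 2) * f t)) t)
    (hg : ∀ t, 0 < t → HasDerivAt g (g' t) t)
    (hg' : ∀ t, 0 < t → HasDerivAt g' (-((1 - c / t ^ 2) * g t)) t)
    (hW : ∀ t, 0 < t → f t * g' t - f' t * g t = W) {y z : ℝ} (hy : 0 < y) (hz : 0 < z) :
    f y * g z - f z * g y = W * (√(amp c y) * √(amp c z) * sin (phase c y z)) := by
  -- the basis `√p cos θ`, `√p sin θ` with `θ = phase c y`, of Wronskian `1`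
  set θ := phase c y
  set a : ℝ → ℝ := fun t => √(amp c t) with ha
  set a' : ℝ → ℝ := fun t => amp' c t / (2 * a t) with ha'
  set e : ℝ → ℝ := fun t => a t * cos (θ t) with he
  set e' : ℝ → ℝ := fun t => a' t * cos (θ t) - sin (θ t) / a t with he'
  set k : ℝ → ℝ := fun t => a t * sin (θ t) with hk
  set k' : ℝ → ℝ := fun t => a' t * sin (θ t) + cos (θ t) / a t with hk'
  have hapos : ∀ t, 0 < a t := fun t => sqrt_pos.2 (amp_pos hc)
  have hsq : ∀ t, amp c t = a t ^ 2 := fun t => (sq_sqrt (amp_pos hc).le).symm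
  have hθ : ∀ t, 0 < t → HasDerivAt θ (a t ^ 2)⁻¹ t := fun t ht => by
    rw [← hsq]; exact hasDerivAt_phase hc hy ht
  have had : ∀ t, 0 < t → HasDerivAt a (a' t) t := fun t ht =>
    (hasDerivAt_amp hc ht).sqrt (amp_pos hc).ne'
  have ha'd : ∀ t, 0 < t → HasDerivAt a' (-((1 - c / t ^ 2) * a t) + (a t ^ 3)⁻¹) t := by
    intro t ht
    refine ((hasDerivAt_amp' hc ht).div ((had t ht).const_mul 2)
      (by have := hapos t; positivity)).congr_deriv ?_
    have h1 := amp_first_integral hc ht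
    rw [hsq] at h1
    have h2 := (hapos t).ne'
    have h3 : amp'' c t = (4 + amp' c t ^ 2 - 4 * (1 - c / t ^ 2) * (a t ^ 2) ^ 2)
        / (2 * a t ^ 2) := by
      field_simp
      field_simp at h1
      linarith
    simp only [ha', h3]
    field_simp
    ring
  have hed : ∀ t, 0 < t → HasDerivAt e (e' t) t := fun t ht => by
    have h2 := (hapos t).ne'
    refine ((had t ht).mul (hθ t ht).cos).congr_deriv ?_
    simp only [he']; field_simp; ring
  have hkd : ∀ t, 0 < t → HasDerivAt k (k' t) t := fun t ht => by
    have h2 := (hapos t).ne'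
    refine ((had t ht).mul (hθ t ht).sin).congr_deriv ?_
    simp only [hk']; field_simp
  have he'd : ∀ t, 0 < t → HasDerivAt e' (-((1 - c / t ^ 2) * e t)) t := fun t ht => by
    have h2 := (hapos t).ne'
    refine (((ha'd t ht).mul (hθ t ht).cos).sub
      ((hθ t ht).sin.div (had t ht) h2)).congr_deriv ?_
    simp only [he]; field_simp; ring
  have hk'd : ∀ t, 0 < t → HasDerivAt k' (-((1 - c / t ^ 2) * k t)) t := fun t ht => by
    have h2 := (hapos t).ne'
    refine (((ha'd t ht).mul (hθ t ht).sin).add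
      ((hθ t ht).cos.div (had t ht) h2)).congr_deriv ?_
    simp only [hk]; field_simp; ring
  have hek : ∀ t, e t * k' t - e' t * k t = 1 := fun t => by
    have h2 := (hapos t).ne'
    simp only [he, he', hk, hk']; field_simp
    linarith [sin_sq_add_cos_sq (θ t)]
  have hθy : θ y = 0 := intervalIntegral.integral_same
  have hWy := hW y hy
  have c1 := wronskian_const (q := fun t => 1 - c / t ^ 2) hf hf' hed he'd hy hz
  have c2 := wronskian_const (q := fun t => 1 - c / t ^ 2) hf hf' hkd hk'd hy hz
  have c3 := wronskian_const (q := fun t => 1 - c / t ^ 2) hg hg' hed he'd hy hz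
  have c4 := wronskian_const (q := fun t => 1 - c / t ^ 2) hg hg' hkd hk'd hy hz
  have fz : f z = (f z * k' z - f' z * k z) * e z - (f z * e' z - f' z * e z) * k z := by
    linear_combination (-f z) * hek z
  have gz : g z = (g z * k' z - g' z * k z) * e z - (g z * e' z - g' z * e z) * k z := by
    linear_combination (-g z) * hek z
  have ey : e y = a y := by simp [he, hθy]
  have ky : k y = 0 := by simp [hk, hθy]
  have eky := hek y
  rw [ey, ky] at eky
  rw [fz, gz, ← c1, ← c2, ← c3, ← c4, ey, ky]
  change _ = W * (a y * a z * sin (θ z))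
  have hkz : a y * a z * sin (θ z) = a y * k z := by simp only [hk]; ring
  rw [hkz]
  linear_combination (a y * k z) * hWy
end

/-! ### Bessel functions of real order -/

theorem exists_bound_inv_Gamma (R : ℝ) : ∃ B : ℝ, ∀ (m : ℕ) (μ : ℂ), ‖μ‖ ≤ R →
    ‖(Complex.Gamma (m + μ + 1))⁻¹‖ ≤ B := by
  have h1 : ∀ m : ℕ, ∃ B : ℝ, ∀ μ : ℂ, ‖μ‖ ≤ R → ‖(Complex.Gamma (m + μ + 1))⁻¹‖ ≤ B := by
    intro m
    have hc : Continuous fun μ : ℂ => (Complex.Gamma (m + μ + 1))⁻¹ :=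
      Complex.differentiable_one_div_Gamma.continuous.comp (by fun_prop)
    obtain ⟨B, hB⟩ := (isCompact_closedBall (0 : ℂ) R).exists_bound_of_continuousOn hc.continuousOn
    exact ⟨B, fun μ hμ => hB μ (by simpa using hμ)⟩
  choose b hb using h1
  obtain ⟨N, hN⟩ := exists_nat_ge R
  refine ⟨∑ m ∈ Finset.range (N + 1), |b m|, fun m μ hμ => ?_⟩
  have hsmall : ∀ m ≤ N, ‖(Complex.Gamma (m + μ + 1))⁻¹‖ ≤ ∑ m ∈ Finset.range (N + 1), |b m| :=
    fun m hm => ((hb m μ hμ).trans (le_abs_self _)).trans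
      (Finset.single_le_sum (f := fun m => |b m|) (fun _ _ => abs_nonneg _)
        (Finset.mem_range.2 (by omega)))
  rcases le_total m N with hm | hm
  · exact hsmall m hm
  · -- beyond `R` the factors `|s|` in `1 / Γ(s) = s / Γ(s + 1)` are at least `1`
    induction m, hm using Nat.le_induction with
    | base => exact hsmall N le_rfl
    | succ m hm ih =>
      refine le_trans ?_ ih
      have hrec := Complex.one_div_Gamma_eq_self_mul_one_div_Gamma_add_one (m + μ + 1)
      have hcast : ((m + 1 : ℕ) : ℂ) + μ + 1 = m + μ + 1 + 1 := by push_cast; ring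
      rw [hcast, hrec, norm_mul]
      refine le_mul_of_one_le_left (norm_nonneg _) ?_
      have h2 : ((m : ℝ) + 1) ≤ ‖(m : ℂ) + μ + 1‖ + ‖μ‖ := by
        have := norm_sub_le ((m : ℂ) + μ + 1) μ
        have h3 : (m : ℂ) + μ + 1 - μ = ((m + 1 : ℕ) : ℂ) := by push_cast; ring
        rw [h3, Complex.norm_natCast] at this
        exact_mod_cast this
      have h4 : (N : ℝ) ≤ m := by exact_mod_cast hm
      linarith

theorem inv_Gamma_eq (s : ℝ) : (Real.Gamma s)⁻¹ = s * (Real.Gamma (s + 1))⁻¹ := by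
  have := Complex.one_div_Gamma_eq_self_mul_one_div_Gamma_add_one (s : ℂ)
  rw [← Complex.ofReal_one, ← Complex.ofReal_add, Complex.Gamma_ofReal, Complex.Gamma_ofReal] at this
  exact_mod_cast this

/-- The coefficients of the entire function `besselE μ`. -/
noncomputable def coeffE (μ : ℝ) (m : ℕ) : ℝ :=
  (-1 : ℝ) ^ m / ((m.factorial : ℝ) * Real.Gamma ((m : ℝ) + μ + 1))

/-- The entire function `∑ₘ (-1)ᵐ zᵐ / (m! Γ(m + μ + 1))`, so that
`J_μ(t) = (t/2)^μ besselE μ ((t/2)²)`. -/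
noncomputable def besselE (μ z : ℝ) : ℝ := ∑' m : ℕ, coeffE μ m * z ^ m

theorem besselJ_eq (μ t : ℝ) : besselJ μ t = (t / 2) ^ μ * besselE μ ((t / 2) ^ 2) := by
  simp only [besselJ, besselE, coeffE, pow_mul]

theorem exists_coeffE_bound (R : ℝ) : ∃ B : ℝ, 0 ≤ B ∧ ∀ (m : ℕ) (μ : ℝ), |μ| ≤ R →
    |coeffE μ m| ≤ B / m.factorial := by
  obtain ⟨B, hB⟩ := exists_bound_inv_Gamma R
  refine ⟨|B|, abs_nonneg B, fun m μ hμ => ?_⟩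
  have h := hB m μ (by simpa using hμ)
  rw [show (m : ℂ) + μ + 1 = ((m + μ + 1 : ℝ) : ℂ) by push_cast; ring, Complex.Gamma_ofReal,
    norm_inv, Complex.norm_real, Real.norm_eq_abs] at h
  rw [coeffE, abs_div, abs_pow, abs_neg, abs_one, one_pow, abs_mul, Nat.abs_cast, one_div, mul_inv,
    mul_comm, div_eq_mul_inv]
  exact mul_le_mul_of_nonneg_right (h.trans (le_abs_self B)) (by positivity)

theorem summable_besselE (μ z : ℝ) : Summable fun m : ℕ => coeffE μ m * z ^ m := by
  obtain ⟨B, -, hB⟩ := exists_coeffE_bound |μ|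
  refine ((Real.summable_pow_div_factorial |z|).mul_left B).of_norm_bounded fun m => ?_
  rw [norm_mul, norm_pow, Real.norm_eq_abs, Real.norm_eq_abs, mul_div_assoc',
    mul_div_right_comm]
  exact mul_le_mul_of_nonneg_right (hB m μ le_rfl) (by positivity)

theorem coeffE_succ_mul (μ : ℝ) (m : ℕ) : coeffE μ (m + 1) * (m + 1) = -coeffE (μ + 1) m := by
  have hf : (m.factorial : ℝ) ≠ 0 := by positivity
  have hm : (m : ℝ) + 1 ≠ 0 := by positivity
  simp only [coeffE, Nat.factorial_succ]
  push_cast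
  rw [show (m : ℝ) + 1 + μ + 1 = m + (μ + 1) + 1 by ring, div_eq_mul_inv, div_eq_mul_inv, mul_inv,
    mul_inv, mul_inv, pow_succ]
  field_simp

theorem hasDerivAt_besselE (μ z : ℝ) : HasDerivAt (besselE μ) (-besselE (μ + 1) z) z := by
  obtain ⟨B, hB0, hB⟩ := exists_coeffE_bound |μ|
  have hu : Summable fun m : ℕ => B / m.factorial * (m * (|z| + 1) ^ (m - 1)) := by
    refine (summable_nat_add_iff 1).1 ?_
    refine ((Real.summable_pow_div_factorial (|z| + 1)).mul_left B).congr fun m => ?_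
    rw [Nat.factorial_succ]
    push_cast
    have : (m : ℝ) + 1 ≠ 0 := by positivity
    field_simp
  have key := hasDerivAt_tsum_of_isPreconnected (t := Metric.ball (0 : ℝ) (|z| + 1)) (y₀ := 0)
    (y := z) (g := fun (m : ℕ) z => coeffE μ m * z ^ m)
    (g' := fun (m : ℕ) z => coeffE μ m * (m * z ^ (m - 1))) hu
    Metric.isOpen_ball (convex_ball (0 : ℝ) _).isPreconnected
    (fun m y _ => (hasDerivAt_pow m y).const_mul _) (fun m y hy => ?_)
    (Metric.mem_ball_self (by positivity)) (summable_besselE μ 0) (by simp)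
  · refine key.congr_deriv ?_
    have hs : Summable fun m : ℕ => coeffE μ m * (m * z ^ (m - 1)) := by
      refine (summable_nat_add_iff 1).1 ((summable_besselE (μ + 1) z).neg.congr fun m => ?_)
      rw [← neg_mul, ← coeffE_succ_mul]; push_cast; simp [mul_assoc]
    rw [hs.tsum_eq_zero_add, besselE, ← tsum_neg]
    simp only [CharP.cast_eq_zero, zero_mul, mul_zero, zero_add]
    congr 1; ext m
    rw [← neg_mul, ← coeffE_succ_mul]; push_cast; simp [mul_assoc]
  · have hy' : |y| ≤ |z| + 1 := by simpa using (Metric.mem_ball.1 hy).le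
    rw [norm_mul, norm_mul, norm_pow, Real.norm_eq_abs, Real.norm_eq_abs, Real.norm_eq_abs,
      Nat.abs_cast]
    refine mul_le_mul (hB m μ le_rfl) ?_ (by positivity) (by positivity)
    gcongr

theorem continuous_besselE (μ : ℝ) : Continuous (besselE μ) :=
  continuous_iff_continuousAt.2 fun z => (hasDerivAt_besselE μ z).continuousAt

theorem besselE_zero (μ : ℝ) : besselE μ 0 = (Real.Gamma (μ + 1))⁻¹ := by
  rw [besselE, tsum_eq_single 0 fun m hm => by simp [hm]]
  simp [coeffE]

theorem coeffE_recurrence (μ : ℝ) (m : ℕ) :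
    coeffE μ m = (m + μ + 1) * coeffE (μ + 1) m := by
  simp only [coeffE, div_eq_mul_inv, mul_inv]
  rw [inv_Gamma_eq (m + μ + 1), show (m : ℝ) + μ + 1 + 1 = m + (μ + 1) + 1 by ring]
  ring

theorem besselE_recurrence (μ z : ℝ) :
    besselE μ z = (μ + 1) * besselE (μ + 1) z - z * besselE (μ + 2) z := by
  have h1 : z * besselE (μ + 2) z = ∑' m : ℕ, -(m * coeffE (μ + 1) m * z ^ m) := by
    have h2 : ∀ m : ℕ, -(((m + 1 : ℕ) : ℝ) * coeffE (μ + 1) (m + 1) * z ^ (m + 1))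
        = z * (coeffE (μ + 2) m * z ^ m) := fun m => by
      have := coeffE_succ_mul (μ + 1) m
      rw [show μ + 1 + 1 = μ + 2 by ring] at this
      push_cast
      rw [pow_succ]
      linear_combination (-(z ^ m * z)) * this
    have hs : Summable fun m : ℕ => -(m * coeffE (μ + 1) m * z ^ m) := by
      refine (summable_nat_add_iff 1).1 ?_
      exact ((summable_besselE (μ + 2) z).mul_left z).congr fun m => (h2 m).symm
    rw [hs.tsum_eq_zero_add, besselE, ← tsum_mul_left]
    simp only [h2]
    simp
  have hs : Summable fun m : ℕ => -(m * coeffE (μ + 1) m * z ^ m) := by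
    have := ((summable_besselE (μ + 1) z).mul_left (μ + 1)).sub (summable_besselE μ z)
    refine this.congr fun m => ?_
    rw [coeffE_recurrence μ m]; ring
  rw [h1, besselE, besselE, ← tsum_mul_left,
    ← ((summable_besselE (μ + 1) z).mul_left (μ + 1)).tsum_sub hs]
  congr 1; ext m
  rw [coeffE_recurrence μ m]; ring

theorem hasDerivAt_besselJ (μ : ℝ) {t : ℝ} (ht : 0 < t) :
    HasDerivAt (besselJ μ) (μ / t * besselJ μ t - besselJ (μ + 1) t) t := by
  have hw : HasDerivAt (fun t : ℝ => t / 2) (1 / 2) t := (hasDerivAt_id t).div_const 2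
  have h1 : HasDerivAt (fun t : ℝ => (t / 2) ^ μ) (1 / 2 * μ * (t / 2) ^ (μ - 1)) t :=
    hw.rpow_const (Or.inl (by positivity))
  have h2 : HasDerivAt (fun t : ℝ => besselE μ ((t / 2) ^ 2))
      (-besselE (μ + 1) ((t / 2) ^ 2) * (t / 2)) t := by
    refine ((hasDerivAt_besselE μ ((t / 2) ^ 2)).comp t (hw.pow 2)).congr_deriv ?_
    push_cast
    ring
  refine ((h1.mul h2).congr_of_eventuallyEq
    (Eventually.of_forall fun t => besselJ_eq μ t)).congr_deriv ?_
  rw [besselJ_eq, besselJ_eq, rpow_sub_one (by positivity), rpow_add_one (by positivity)]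
  field_simp
  ring

theorem besselJ_recurrence (μ : ℝ) {t : ℝ} (ht : 0 < t) :
    besselJ μ t = 2 * (μ + 1) / t * besselJ (μ + 1) t - besselJ (μ + 2) t := by
  rw [besselJ_eq, besselJ_eq, besselJ_eq, besselE_recurrence, rpow_add_one (by positivity),
    rpow_add (by positivity), rpow_two]
  field_simp

/-- The function `√t J_μ(t)`, a solution of `u'' + (1 - (μ² - 1/4) / t²) u = 0`. -/
noncomputable def sqrtJ (μ t : ℝ) : ℝ := √t * besselJ μ t

/-- The derivative of `sqrtJ μ`. -/
noncomputable def sqrtJ' (μ t : ℝ) : ℝ := (μ + 1 / 2) / t * sqrtJ μ t - sqrtJ (μ + 1) t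

theorem hasDerivAt_sqrt_mul {f : ℝ → ℝ} {f' t : ℝ} (hf : HasDerivAt f f' t) (ht : 0 < t) :
    HasDerivAt (fun t => √t * f t) (1 / 2 / t * (√t * f t) + √t * f') t := by
  refine ((hasDerivAt_sqrt ht.ne').mul hf).congr_deriv ?_
  have h1 := sq_sqrt ht.le
  have h2 := (sqrt_pos.2 ht).ne'
  field_simp
  rw [h1]; ring

theorem hasDerivAt_sqrtJ (μ : ℝ) {t : ℝ} (ht : 0 < t) :
    HasDerivAt (sqrtJ μ) (sqrtJ' μ t) t := by
  refine (hasDerivAt_sqrt_mul (hasDerivAt_besselJ μ ht) ht).congr_deriv ?_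
  simp only [sqrtJ', sqrtJ]
  ring

theorem hasDerivAt_sqrtJ_succ (μ : ℝ) {t : ℝ} (ht : 0 < t) :
    HasDerivAt (sqrtJ (μ + 1)) (sqrtJ μ t - (μ + 1 / 2) / t * sqrtJ (μ + 1) t) t := by
  refine (hasDerivAt_sqrtJ (μ + 1) ht).congr_deriv ?_
  simp only [sqrtJ', sqrtJ]
  rw [besselJ_recurrence μ ht, show μ + 1 + 1 = μ + 2 by ring]
  field_simp
  ring

theorem hasDerivAt_sqrtJ' (μ : ℝ) {t : ℝ} (ht : 0 < t) :
    HasDerivAt (sqrtJ' μ) (-((1 - (μ ^ 2 - 1 / 4) / t ^ 2) * sqrtJ μ t)) t := by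
  refine ((((hasDerivAt_const t (μ + 1 / 2)).fun_div (hasDerivAt_id t) ht.ne').mul
    (hasDerivAt_sqrtJ μ ht)).sub (hasDerivAt_sqrtJ_succ μ ht)).congr_deriv ?_
  simp only [sqrtJ', id]
  field_simp
  ring

/-- The Wronskian of `√t J_μ` and `√t J_{-μ}`, evaluated in the limit `t → 0`. -/
theorem wronskian_sqrtJ {μ : ℝ} (hμ : μ ≠ 0) {t : ℝ} (ht : 0 < t) :
    sqrtJ μ t * sqrtJ' (-μ) t - sqrtJ' μ t * sqrtJ (-μ) t = -(2 / π * sin (μ * π)) := by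
  set F : ℝ → ℝ := fun t => -2 * μ * (besselE μ ((t / 2) ^ 2) * besselE (-μ) ((t / 2) ^ 2))
    - 2 * (t / 2) ^ 2 * (besselE μ ((t / 2) ^ 2) * besselE (-μ + 1) ((t / 2) ^ 2)
      - besselE (μ + 1) ((t / 2) ^ 2) * besselE (-μ) ((t / 2) ^ 2)) with hF
  have hWF : ∀ r : ℝ, 0 < r → sqrtJ μ r * sqrtJ' (-μ) r - sqrtJ' μ r * sqrtJ (-μ) r = F r := by
    intro r hr
    have hr2 : 0 < r / 2 := half_pos hr
    have h1 : √r * √r = r := mul_self_sqrt hr.le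
    have h2 : (r / 2) ^ μ * (r / 2) ^ (-μ) = 1 := by
      rw [← rpow_add hr2]; simp
    have e1 : sqrtJ μ r * sqrtJ' (-μ) r - sqrtJ' μ r * sqrtJ (-μ) r
        = (√r * √r) * (-2 * μ / r * (besselJ μ r * besselJ (-μ) r)
          - besselJ μ r * besselJ (-μ + 1) r + besselJ (μ + 1) r * besselJ (-μ) r) := by
      simp only [sqrtJ', sqrtJ]; ring
    rw [e1, h1]
    simp only [besselJ_eq, rpow_add_one hr2.ne', hF]
    have e2 : ∀ a b : ℝ, (r / 2) ^ μ * a * ((r / 2) ^ (-μ) * b) = a * b := fun a b => by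
      linear_combination (a * b) * h2
    have e3 : ∀ a b d : ℝ, (r / 2) ^ μ * a * ((r / 2) ^ (-μ) * d * b) = a * b * d := fun a b d => by
      linear_combination (a * b * d) * h2
    have e4 : ∀ a b d : ℝ, (r / 2) ^ μ * d * a * ((r / 2) ^ (-μ) * b) = a * b * d := fun a b d => by
      linear_combination (a * b * d) * h2
    rw [e2, e3, e4]
    field_simp
    ring
  have hcont : Continuous F := by
    have := continuous_besselE
    have h1 : ∀ μ, Continuous fun t : ℝ => besselE μ ((t / 2) ^ 2) := fun μ =>
      (this μ).comp (by fun_prop)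
    have h2 := h1 μ
    have h3 := h1 (-μ)
    have h4 := h1 (μ + 1)
    have h5 := h1 (-μ + 1)
    fun_prop
  have hconst : ∀ r : ℝ, 0 < r → F r = F t := fun r hr => by
    rw [← hWF r hr, ← hWF t ht]
    refine wronskian_const (q := fun t => 1 - (μ ^ 2 - 1 / 4) / t ^ 2)
      (fun t ht => hasDerivAt_sqrtJ μ ht) (fun t ht => hasDerivAt_sqrtJ' μ ht)
      (fun t ht => hasDerivAt_sqrtJ (-μ) ht) (fun t ht => ?_) hr ht
    simpa only [neg_sq] using hasDerivAt_sqrtJ' (-μ) ht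
  have hlim : Tendsto F (𝓝[>] 0) (𝓝 (F 0)) := (hcont.tendsto 0).mono_left nhdsWithin_le_nhds
  have hlim' : Tendsto F (𝓝[>] 0) (𝓝 (F t)) := by
    refine tendsto_const_nhds.congr' ?_
    filter_upwards [self_mem_nhdsWithin] with r hr using (hconst r hr).symm
  rw [hWF t ht, tendsto_nhds_unique hlim' hlim]
  have hrefl := Real.Gamma_mul_Gamma_one_sub μ
  simp only [hF, zero_div, ne_eq, OfNat.ofNat_ne_zero, not_false_eq_true, zero_pow, besselE_zero,
    mul_zero, zero_mul, sub_zero]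
  rw [Real.Gamma_add_one hμ, ← mul_inv, show -μ + 1 = 1 - μ by ring, mul_assoc μ, hrefl,
    mul_comm π μ]
  rw [mul_inv, inv_div]
  field_simp

theorem sin_mul_pi_ne_zero {μ : ℝ} (hμ : ¬∃ n : ℤ, μ = n) : sin (μ * π) ≠ 0 := by
  rw [Ne, Real.sin_eq_zero_iff]
  rintro ⟨n, hn⟩
  exact hμ ⟨n, (mul_right_cancel₀ pi_ne_zero hn).symm⟩

/-- The amplitude-phase form of the cross product for non-integral order. -/
theorem kernel_quotient {μ : ℝ} (hμ : 1 / 2 ≤ μ) (hn : ¬∃ n : ℤ, μ = n) {y z : ℝ} (hy : 0 < y)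
    (hz : 0 < z) :
    √y * √z * (besselJ μ y * besselYQuotient μ z - besselJ μ z * besselYQuotient μ y)
      = 2 / π * (√(amp (μ ^ 2 - 1 / 4) y) * √(amp (μ ^ 2 - 1 / 4) z)
        * sin (phase (μ ^ 2 - 1 / 4) y z)) := by
  have hs := sin_mul_pi_ne_zero hn
  have hW := fun t (ht : 0 < t) => wronskian_sqrtJ (by linarith : μ ≠ 0) ht
  have key := kernel_eq (c := μ ^ 2 - 1 / 4) (by nlinarith) (f := sqrtJ μ) (f' := sqrtJ' μ)
    (g := sqrtJ (-μ)) (g' := sqrtJ' (-μ)) (fun t ht => hasDerivAt_sqrtJ μ ht)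
    (fun t ht => hasDerivAt_sqrtJ' μ ht) (fun t ht => hasDerivAt_sqrtJ (-μ) ht)
    (fun t ht => by simpa only [neg_sq] using hasDerivAt_sqrtJ' (-μ) ht) hW hy hz
  simp only [sqrtJ] at key
  simp only [besselYQuotient]
  field_simp at key ⊢
  linear_combination (-1 : ℝ) * key

/-! ### Integral order -/

theorem differentiableAt_besselE_order (z μ : ℝ) :
    DifferentiableAt ℝ (fun μ => besselE μ z) μ := by
  obtain ⟨B, hB⟩ := exists_bound_inv_Gamma (|μ| + 1)
  set F : ℕ → ℂ → ℂ := fun m w =>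
    (-1) ^ m * z ^ m / m.factorial * (Complex.Gamma (m + w + 1))⁻¹ with hF
  have hre : ∀ x : ℝ, besselE x z = (∑' m, F m x).re := fun x => by
    have : ∀ m, F m x = ((coeffE x m * z ^ m : ℝ) : ℂ) := fun m => by
      simp only [hF, coeffE]
      rw [show (m : ℂ) + x + 1 = ((m + x + 1 : ℝ) : ℂ) by push_cast; ring, Complex.Gamma_ofReal]
      push_cast
      rw [div_eq_mul_inv, div_eq_mul_inv, mul_inv]
      ring
    simp only [this, ← Complex.ofReal_tsum, Complex.ofReal_re, besselE]
  have hd : DifferentiableOn ℂ (fun w => ∑' m, F m w) (Metric.ball 0 (|μ| + 1)) := by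
    refine Complex.differentiableOn_tsum_of_summable_norm
      ((Real.summable_pow_div_factorial |z|).mul_right B) (fun m => ?_) Metric.isOpen_ball
      fun m w hw => ?_
    · refine Differentiable.differentiableOn ?_
      exact (Complex.differentiable_one_div_Gamma.comp
        (by fun_prop : Differentiable ℂ fun w : ℂ => (m : ℂ) + w + 1)).const_mul _
    · have h1 := hB m w (by simpa using (Metric.mem_ball.1 hw).le)
      simp only [hF]
      rw [norm_mul]
      refine (mul_le_mul_of_nonneg_left h1 (norm_nonneg _)).trans_eq ?_
      simp
  have h1 : DifferentiableAt ℂ (fun w => ∑' m, F m w) (μ : ℂ) :=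
    hd.differentiableAt (Metric.isOpen_ball.mem_nhds (by simp))
  exact (h1.hasDerivAt.real_of_complex.congr_of_eventuallyEq
    (Eventually.of_forall hre)).differentiableAt

theorem differentiableAt_besselJ_order {t : ℝ} (ht : 0 < t) (μ : ℝ) :
    DifferentiableAt ℝ (fun μ => besselJ μ t) μ := by
  simp only [besselJ_eq]
  refine DifferentiableAt.mul ?_ (differentiableAt_besselE_order _ μ)
  exact ((hasDerivAt_id μ).const_rpow (half_pos ht)).differentiableAt

theorem besselJ_neg_nat (n : ℕ) {t : ℝ} (ht : 0 < t) :
    besselJ (-n) t = (-1) ^ n * besselJ n t := by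
  have hE : ∀ z : ℝ, besselE (-n) z = (-1) ^ n * z ^ n * besselE n z := fun z => by
    have h0 : ∑ m ∈ Finset.range n, coeffE (-n) m * z ^ m = 0 := by
      refine Finset.sum_eq_zero fun m hm => ?_
      have hm' : m + 1 ≤ n := Finset.mem_range.1 hm
      have : (m : ℝ) + -n + 1 = -((n - (m + 1) : ℕ) : ℝ) := by
        rw [Nat.cast_sub hm']; push_cast; ring
      simp [coeffE, this, Real.Gamma_neg_nat_eq_zero]
    rw [besselE, ← (summable_besselE (-n) z).sum_add_tsum_nat_add n, h0, zero_add, besselE,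
      ← tsum_mul_left]
    congr 1; ext m
    have h1 : ((m + n : ℕ) : ℝ) + -n + 1 = m + 1 := by push_cast; ring
    have h2 : (m : ℝ) + n + 1 = ((m + n : ℕ) : ℝ) + 1 := by push_cast; ring
    rw [coeffE, coeffE, h1, h2, Real.Gamma_nat_eq_factorial, Real.Gamma_nat_eq_factorial,
      pow_add, pow_add]
    ring
  have hw : 0 < t / 2 := half_pos ht
  have hwn : (t / 2) ^ n ≠ 0 := by positivity
  rw [besselJ_eq, besselJ_eq, hE, rpow_neg hw.le, rpow_natCast, ← pow_mul, mul_comm 2 n, pow_mul]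
  field_simp

theorem eventually_not_int (n : ℕ) : ∀ᶠ μ : ℝ in 𝓝[≠] (n : ℝ), ¬∃ k : ℤ, μ = k := by
  filter_upwards [self_mem_nhdsWithin, nhdsWithin_le_nhds
    (Ioo_mem_nhds (sub_one_lt (n : ℝ)) (lt_add_one (n : ℝ)))] with μ h1 h2
  rintro ⟨k, rfl⟩
  have h3 : (n : ℤ) - 1 < k := by exact_mod_cast h2.1
  have h4 : k < (n : ℤ) + 1 := by exact_mod_cast h2.2
  have h5 : k = n := by omega
  exact h1 (by simp [h5])

/-- The limit defining `Y_n` exists: it is a quotient of derivatives with respect to the order. -/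
theorem tendsto_besselYQuotient (n : ℕ) {t : ℝ} (ht : 0 < t) :
    Tendsto (fun μ => besselYQuotient μ t) (𝓝[≠] (n : ℝ)) (𝓝 (besselY n t)) := by
  suffices h : ∃ l, Tendsto (fun μ => besselYQuotient μ t) (𝓝[≠] (n : ℝ)) (𝓝 l) by
    have : besselY n t = limUnder (𝓝[≠] (n : ℝ)) fun μ => besselYQuotient μ t :=
      if_pos ⟨n, by simp⟩
    rw [this]
    exact tendsto_nhds_limUnder h
  have hN : DifferentiableAt ℝ (fun μ => besselJ μ t * cos (μ * π) - besselJ (-μ) t) n := by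
    refine ((differentiableAt_besselJ_order ht n).mul (by fun_prop)).sub ?_
    exact DifferentiableAt.comp (n : ℝ) (g := fun μ => besselJ μ t)
      (differentiableAt_besselJ_order ht _) (by fun_prop)
  have hS : HasDerivAt (fun μ : ℝ => sin (μ * π)) (cos (n * π) * π) n := by
    simpa using ((hasDerivAt_id (n : ℝ)).mul_const π).sin
  have hS0 : cos (n * π) * π ≠ 0 := by
    rw [Real.cos_nat_mul_pi]; exact mul_ne_zero (pow_ne_zero _ (by norm_num)) pi_ne_zero
  refine ⟨_, ((hasDerivAt_iff_tendsto_slope.1 hN.hasDerivAt).div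
    (hasDerivAt_iff_tendsto_slope.1 hS) hS0).congr' ?_⟩
  filter_upwards [self_mem_nhdsWithin] with μ hμ
  have h1 : μ - n ≠ 0 := sub_ne_zero.2 hμ
  rw [Pi.div_apply, slope_def_field, slope_def_field, Real.cos_nat_mul_pi, Real.sin_nat_mul_pi,
    besselJ_neg_nat n ht, mul_comm ((-1) ^ n), sub_self, sub_zero, sub_zero,
    div_div_div_cancel_right₀ h1]
  rfl

/-- The amplitude-phase form of the cross product. For integral order it is obtained from
neighbouring non-integral orders, all terms being continuous in the order. -/
theorem kernel_bessel {ν : ℝ} (hν : 1 / 2 ≤ ν) {y z : ℝ} (hy : 0 < y) (hz : 0 < z) :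
    √y * √z * (besselJ ν y * besselY ν z - besselJ ν z * besselY ν y)
      = 2 / π * (√(amp (ν ^ 2 - 1 / 4) y) * √(amp (ν ^ 2 - 1 / 4) z)
        * sin (phase (ν ^ 2 - 1 / 4) y z)) := by
  by_cases hn : ∃ n : ℤ, ν = n
  · obtain ⟨k, rfl⟩ := hn
    have hk : (1 : ℤ) ≤ k := by
      by_contra! h
      have : (k : ℝ) ≤ 0 := by exact_mod_cast (by omega : k ≤ 0)
      linarith
    obtain ⟨n, rfl⟩ : ∃ n : ℕ, k = n := ⟨k.toNat, by omega⟩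
    have hn1 : (1 : ℝ) ≤ n := by exact_mod_cast hk
    simp only [Int.cast_natCast] at hν ⊢
    have hJ : ∀ t : ℝ, 0 < t → Tendsto (fun μ => besselJ μ t) (𝓝[≠] (n : ℝ))
        (𝓝 (besselJ n t)) := fun t ht =>
      (differentiableAt_besselJ_order ht n).continuousAt.tendsto.mono_left nhdsWithin_le_nhds
    have hY := fun t (ht : 0 < t) => tendsto_besselYQuotient n ht
    have hc : (0 : ℝ) ≤ (n : ℝ) ^ 2 - 1 / 4 := by nlinarith
    have hγ : Tendsto (fun μ : ℝ => μ ^ 2 - 1 / 4) (𝓝[≠] (n : ℝ)) (𝓝 ((n : ℝ) ^ 2 - 1 / 4)) :=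
      ((by fun_prop : Continuous fun μ : ℝ => μ ^ 2 - 1 / 4).tendsto _).mono_left
        nhdsWithin_le_nhds
    have hhalf : ∀ᶠ μ : ℝ in 𝓝[≠] (n : ℝ), 1 / 2 ≤ μ :=
      nhdsWithin_le_nhds (Ici_mem_nhds (by linarith))
    have hγ0 : ∀ᶠ μ : ℝ in 𝓝[≠] (n : ℝ), 0 ≤ μ ^ 2 - 1 / 4 :=
      hhalf.mono fun μ hμ => by nlinarith
    have hl := (((hJ y hy).mul (hY z hz)).sub ((hJ z hz).mul (hY y hy))).const_mul (√y * √z)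
    have hr := ((((tendsto_amp_param hc hγ hγ0 hy).sqrt).mul
      ((tendsto_amp_param hc hγ hγ0 hz).sqrt)).mul
      ((continuous_sin.tendsto _).comp (tendsto_phase_param hc hγ hγ0 hy hz))).const_mul (2 / π)
    refine tendsto_nhds_unique (hl.congr' ?_) hr
    filter_upwards [eventually_not_int n, hhalf] with μ h1 h2
    exact kernel_quotient h2 h1 hy hz
  · have hY : besselY ν = besselYQuotient ν := by ext t; exact if_neg hn
    rw [hY]
    exact kernel_quotient hν hn hy hz

/-! ### Level curves of the phase difference -/

section
variable {c : ℝ}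

theorem strictMonoOn_phase (hc : 0 ≤ c) {y : ℝ} (hy : 0 < y) :
    StrictMonoOn (phase c y) (Ioi 0) := by
  refine strictMonoOn_of_deriv_pos (convex_Ioi 0)
    (fun z hz => (hasDerivAt_phase hc hy hz).continuousAt.continuousWithinAt) fun z hz => ?_
  rw [interior_Ioi] at hz
  rw [(hasDerivAt_phase hc hy hz).deriv]
  exact inv_pos.2 (amp_pos hc)

theorem phase_self (c y : ℝ) : phase c y y = 0 := intervalIntegral.integral_same

theorem phase_pos (hc : 0 ≤ c) {y z : ℝ} (hy : 0 < y) (hyz : y < z) : 0 < phase c y z :=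
  (phase_self c y).symm.trans_lt (strictMonoOn_phase hc hy hy (hy.trans hyz) hyz)

theorem phase_le_sub (hc : 0 ≤ c) {y z : ℝ} (hy : 0 < y) (hyz : y ≤ z) :
    phase c y z ≤ z - y := by
  have h := intervalIntegral.integral_mono_on hyz
    (intervalIntegrable_inv_amp hc hy (hy.trans_le hyz))
    (intervalIntegrable_const (c := (1 : ℝ))) fun t _ => inv_le_one_of_one_le₀ (one_le_amp hc)
  simpa [phase] using h

theorem sub_mul_inv_amp_le_phase (hc : 0 ≤ c) {y z : ℝ} (hy : 0 < y) (hyz : y ≤ z) :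
    (z - y) * (amp c y)⁻¹ ≤ phase c y z := by
  have h := intervalIntegral.integral_mono_on hyz
    (intervalIntegrable_const (c := (amp c y)⁻¹))
    (intervalIntegrable_inv_amp hc hy (hy.trans_le hyz)) fun t ht =>
      inv_anti₀ (amp_pos hc) (antitoneOn_amp hc hy (hy.trans_le ht.1) ht.1)
  simpa [phase] using h

theorem hasDerivAt_phase_mul (hc : 0 ≤ c) {x y : ℝ} (hx : 0 < x) (hy : 0 < y) :
    HasDerivAt (fun y => phase c y (x * y)) (x * (amp c (x * y))⁻¹ - (amp c y)⁻¹) y := by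
  have h1 := ((hasDerivAt_phase hc one_pos (mul_pos hx hy)).comp y
    ((hasDerivAt_id y).const_mul x)).sub (hasDerivAt_phase hc one_pos hy)
  refine (h1.congr_of_eventuallyEq ?_).congr_deriv (by ring)
  filter_upwards [Ioi_mem_nhds hy] with r hr
  have := phase_add hc one_pos hr (mul_pos hx hr)
  simp only [Pi.sub_apply, Function.comp_apply]
  linarith

theorem strictMonoOn_phase_mul (hc : 0 ≤ c) {x : ℝ} (hx : 1 < x) :
    StrictMonoOn (fun y => phase c y (x * y)) (Ioi 0) := by
  have hx0 : 0 < x := one_pos.trans hx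
  refine strictMonoOn_of_deriv_pos (convex_Ioi 0)
    (fun y hy => (hasDerivAt_phase_mul hc hx0 hy).continuousAt.continuousWithinAt) fun y hy => ?_
  rw [interior_Ioi] at hy
  have hy' : (0 : ℝ) < y := hy
  rw [(hasDerivAt_phase_mul hc hx0 hy').deriv]
  have h1 : (amp c y)⁻¹ ≤ (amp c (x * y))⁻¹ :=
    inv_anti₀ (amp_pos hc) (antitoneOn_amp hc hy' (mul_pos hx0 hy') (by nlinarith))
  have h2 : 0 < (amp c y)⁻¹ := inv_pos.2 (amp_pos hc)
  nlinarith

theorem exists_phase_mul_eq (hc : 0 ≤ c) {x r : ℝ} (hx : 1 < x) (hr : 0 < r) :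
    ∃ y, 0 < y ∧ phase c y (x * y) = r := by
  have hx0 : 0 < x := one_pos.trans hx
  have hx1 : 0 < x - 1 := sub_pos.2 hx
  have hA : 0 < amp c 1 := amp_pos hc
  set a := r / (x - 1) with ha
  set b := r / (x - 1) * amp c 1 + 1 with hb
  have ha0 : 0 < a := by positivity
  have hb1 : 1 ≤ b := by have : 0 ≤ r / (x - 1) * amp c 1 := by positivity
                         linarith
  have hfa : phase c a (x * a) ≤ r := by
    refine (phase_le_sub hc ha0 (by nlinarith)).trans_eq ?_
    rw [ha]; field_simp
  have hfb : r ≤ phase c b (x * b) := by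
    refine le_trans ?_ (sub_mul_inv_amp_le_phase hc (by linarith) (by nlinarith))
    have h1 : (amp c 1)⁻¹ ≤ (amp c b)⁻¹ := inv_anti₀ (amp_pos hc)
      (antitoneOn_amp hc (mem_Ioi.2 one_pos) (mem_Ioi.2 (by linarith)) hb1)
    calc r = (x - 1) * (r / (x - 1) * amp c 1) * (amp c 1)⁻¹ := by field_simp
      _ ≤ (x - 1) * b * (amp c b)⁻¹ := by
        have : 0 ≤ (amp c 1)⁻¹ := by positivity
        gcongr
        linarith
      _ = _ := by ring
  obtain ⟨y, hy, hy'⟩ := isPreconnected_Ioi.intermediate_value (s := Ioi (0 : ℝ)) ha0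
    (mem_Ioi.2 (by linarith : 0 < b))
    (fun y hy => (hasDerivAt_phase_mul hc hx0 hy).continuousAt.continuousWithinAt) ⟨hfa, hfb⟩
  exact ⟨y, hy, hy'⟩

theorem exists_phase_eq (hc : 0 ≤ c) {y r : ℝ} (hy : 0 < y) (hr : 0 < r) :
    ∃ z, y < z ∧ phase c y z = r := by
  have hA : 0 < amp c y := amp_pos hc
  have h0 : 0 < r * amp c y := by positivity
  have hfb : r ≤ phase c y (y + r * amp c y) := by
    refine le_trans (le_of_eq ?_) (sub_mul_inv_amp_le_phase hc hy (by linarith))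
    field_simp; ring
  obtain ⟨z, hz, hz'⟩ := isPreconnected_Ioi.intermediate_value (s := Ioi (0 : ℝ)) hy
    (mem_Ioi.2 (by linarith : 0 < y + r * amp c y))
    (fun z hz => (hasDerivAt_phase hc hy hz).continuousAt.continuousWithinAt)
    ⟨(phase_self c y).le.trans hr.le, hfb⟩
  refine ⟨z, ?_, hz'⟩
  by_contra! hle
  have := (strictMonoOn_phase hc hy).monotoneOn hz hy hle
  rw [hz', phase_self] at this
  linarith

open Classical in
/-- For `y > 0` and `r > 0`, the point `z > y` at which the phase exceeds that at `y` by `r`. -/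
noncomputable def advance (c r y : ℝ) : ℝ :=
  if h : ∃ z, y < z ∧ phase c y z = r then h.choose else y

theorem advance_spec (hc : 0 ≤ c) {y r : ℝ} (hy : 0 < y) (hr : 0 < r) :
    y < advance c r y ∧ phase c y (advance c r y) = r := by
  have h := exists_phase_eq hc hy hr
  rw [advance, dif_pos h]
  exact h.choose_spec

theorem hasDerivAt_advance (hc : 0 ≤ c) {y r : ℝ} (hy : 0 < y) (hr : 0 < r) :
    HasDerivAt (advance c r) (amp c (advance c r y) / amp c y) y := by
  obtain ⟨h1, h2⟩ := advance_spec hc hy hr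
  set z := advance c r y with hz
  have hz0 : 0 < z := hy.trans h1
  have hθ := hasStrictDerivAt_phase hc one_pos hz0
  have hne : (amp c z)⁻¹ ≠ 0 := (inv_pos.2 (amp_pos hc)).ne'
  -- `advance c r` agrees near `y` with `ψ (θ y + r)`, where `ψ` is a local inverse of the phase `θ`
  set ψ := hθ.localInverse _ _ _ hne with hψ
  have hψd : HasStrictDerivAt ψ (amp c z)⁻¹⁻¹ (phase c 1 z) := hθ.to_localInverse hne
  have hψr : ∀ᶠ s in 𝓝 (phase c 1 z), phase c 1 (ψ s) = s :=
    (hθ.hasStrictFDerivAt_equiv hne).eventually_right_inverse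
  have hψz : ψ (phase c 1 z) = z := (hθ.hasStrictFDerivAt_equiv hne).localInverse_apply_image
  have hsum : ∀ s, 0 < s → phase c 1 (advance c r s) = phase c 1 s + r := fun s hs => by
    obtain ⟨h3, h4⟩ := advance_spec hc hs hr
    rw [← phase_add hc one_pos hs (hs.trans h3), h4]
  have hg : HasDerivAt (fun s => phase c 1 s + r) (amp c y)⁻¹ y :=
    (hasDerivAt_phase hc one_pos hy).add_const r
  have hcomp : HasDerivAt (fun s => ψ (phase c 1 s + r)) ((amp c z)⁻¹⁻¹ * (amp c y)⁻¹) y := by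
    refine HasDerivAt.comp y (h₂ := ψ) ?_ hg
    rw [← hsum y hy, ← hz]
    exact hψd.hasDerivAt
  have hlim : Tendsto (fun s => phase c 1 s + r) (𝓝 y) (𝓝 (phase c 1 z)) := by
    rw [hz, hsum y hy]; exact hg.continuousAt
  have hψpos : ∀ᶠ s in 𝓝 (phase c 1 z), 0 < ψ s := by
    refine hψd.hasDerivAt.continuousAt.eventually (lt_mem_nhds ?_)
    rw [hψz]; exact hz0
  rw [inv_inv, ← div_eq_mul_inv] at hcomp
  refine hcomp.congr_of_eventuallyEq ?_
  filter_upwards [Ioi_mem_nhds hy, hlim.eventually hψr, hlim.eventually hψpos] with s hs h3 h4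
  refine (strictMonoOn_phase hc one_pos).injOn (hs.trans (advance_spec hc hs hr).1) h4 ?_
  rw [h3, hsum s hs]

/-- Along a level curve of the phase difference, the ratio `x = z / y` is a convex function of `y`.
This is where convexity of the squared amplitude enters. -/
theorem convexOn_advance_div (hc : 0 ≤ c) {r : ℝ} (hr : 0 < r) :
    ConvexOn ℝ (Ioi 0) fun y => advance c r y / y := by
  set z := advance c r
  have hd : ∀ y : ℝ, 0 < y → HasDerivAt (fun y => z y / y)
      (amp c (z y) / (amp c y * y) - z y / y ^ 2) y := fun y hy => by
    refine ((hasDerivAt_advance hc hy hr).div (hasDerivAt_id y) hy.ne').congr_deriv ?_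
    have : amp c y ≠ 0 := (amp_pos hc).ne'
    simp only [id, z]
    field_simp
  have hd2 : ∀ y : ℝ, 0 < y → HasDerivAt (fun y => amp c (z y) / (amp c y * y) - z y / y ^ 2)
      (amp c (z y) / (amp c y ^ 2 * y) * (amp' c (z y) - amp' c y)
        + 2 / y ^ 2 * (z y / y - amp c (z y) / amp c y)) y := fun y hy => by
    have hp : amp c y ≠ 0 := (amp_pos hc).ne'
    have hz0 : 0 < z y := hy.trans (advance_spec hc hy hr).1
    have hz := hasDerivAt_advance hc hy hr
    have h1 := (hasDerivAt_amp hc hz0).comp y hz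
    refine ((h1.div ((hasDerivAt_amp hc hy).mul (hasDerivAt_id y))
      (mul_ne_zero hp hy.ne')).sub (hz.div (hasDerivAt_pow 2 y) (by positivity))).congr_deriv ?_
    simp only [id, Function.comp_apply, Pi.mul_apply]
    change (amp' c (z y) * (amp c (z y) / amp c y) * (amp c y * y) - amp c (z y)
      * (amp' c y * y + amp c y * 1)) / (amp c y * y) ^ 2 - _ = _
    change _ - (amp c (z y) / amp c y * y ^ 2 - z y * _) / _ = _
    push_cast
    field_simp
    ring
  refine convexOn_of_hasDerivWithinAt2_nonneg (convex_Ioi 0)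
    (fun y hy => (hd y hy).continuousAt.continuousWithinAt)
    (fun y hy => (hd y (interior_subset hy)).hasDerivWithinAt)
    (fun y hy => (hd2 y (interior_subset hy)).hasDerivWithinAt) fun y hy => ?_
  have hy0 : 0 < y := interior_subset hy
  have hzy : y < z y := (advance_spec hc hy0 hr).1
  have hz0 : 0 < z y := hy0.trans hzy
  have hp := amp_pos (c := c) (t := y) hc
  have hpz := amp_pos (c := c) (t := z y) hc
  have h1 : amp' c y ≤ amp' c (z y) := monotoneOn_amp' hc hy0 hz0 hzy.le
  have h2 : amp c (z y) / amp c y ≤ 1 := (div_le_one hp).2 (antitoneOn_amp hc hy0 hz0 hzy.le)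
  have h3 : 1 ≤ z y / y := (one_le_div hy0).2 hzy.le
  have h4 : 0 ≤ amp' c (z y) - amp' c y := sub_nonneg.2 h1
  have h5 : 0 ≤ z y / y - amp c (z y) / amp c y := sub_nonneg.2 (h2.trans h3)
  positivity

/-- If the zeros of `f` are the points where the phase difference `θ(xy) - θ(y)` is a multiple of
`π`, the `k`-th zero is the point where it equals `k π`. -/
theorem isNthPosZero_of_phase_eq (hc : 0 ≤ c) {x : ℝ} (hx : 1 < x) {f : ℝ → ℝ}
    (hf : ∀ y, 0 < y → (f y = 0 ↔ sin (phase c y (x * y)) = 0)) {k : ℕ} {y : ℝ}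
    (hy : 0 < y) (hyk : phase c y (x * y) = k * π) : IsNthPosZero f k y := by
  have hmono := strictMonoOn_phase_mul hc hx
  refine ⟨hy, (hf y hy).2 (by rw [hyk, Real.sin_nat_mul_pi]), ?_⟩
  have hex : ∀ j : ℕ, ∃ y, 1 ≤ j → 0 < y ∧ phase c y (x * y) = j * π := fun j => by
    by_cases hj : 1 ≤ j
    · have hj' : (0 : ℝ) < j := by exact_mod_cast hj
      obtain ⟨y, h⟩ := exists_phase_mul_eq hc hx (mul_pos hj' pi_pos)
      exact ⟨y, fun _ => h⟩
    · exact ⟨0, fun h => absurd h hj⟩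
  choose Y hY using hex
  have himg : {t : ℝ | 0 < t ∧ t ≤ y ∧ f t = 0} = Y '' Finset.Icc 1 k := by
    ext t
    constructor
    · rintro ⟨h0, hty, hft⟩
      obtain ⟨n, hn⟩ := Real.sin_eq_zero_iff.1 ((hf t h0).1 hft)
      have hpos : 0 < (n : ℝ) * π := by
        rw [hn]; exact phase_pos hc h0 (by nlinarith)
      have hle : (n : ℝ) * π ≤ k * π := by
        rw [hn, ← hyk]; exact hmono.monotoneOn h0 hy hty
      have hn0 : 0 < n := by exact_mod_cast pos_of_mul_pos_left hpos pi_pos.le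
      have hnk : n ≤ k := by exact_mod_cast le_of_mul_le_mul_right hle pi_pos
      obtain ⟨m, rfl⟩ : ∃ m : ℕ, n = m := ⟨n.toNat, by omega⟩
      have hm1 : 1 ≤ m := by omega
      refine ⟨m, by simp; omega, ?_⟩
      refine hmono.injOn (hY m hm1).1 h0 ?_
      simp only [(hY m hm1).2, ← hn, Int.cast_natCast]
    · rintro ⟨j, hj, rfl⟩
      have hj' : 1 ≤ j ∧ j ≤ k := by simpa using hj
      obtain ⟨h0, h1⟩ := hY j hj'.1
      refine ⟨h0, ?_, (hf _ h0).2 (by rw [h1, Real.sin_nat_mul_pi])⟩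
      refine (hmono.le_iff_le h0 hy).1 ?_
      simp only [h1, hyk]
      have : (j : ℝ) ≤ k := by exact_mod_cast hj'.2
      gcongr
  have hinj : InjOn Y (Finset.Icc 1 k : Finset ℕ) := by
    intro i hi j hj hij
    have hi' : 1 ≤ i ∧ i ≤ k := by simpa using hi
    have hj' : 1 ≤ j ∧ j ≤ k := by simpa using hj
    have h1 := (hY i hi'.1).2
    rw [hij, (hY j hj'.1).2] at h1
    exact_mod_cast (mul_right_cancel₀ pi_ne_zero h1).symm
  rw [himg, hinj.encard_image, Set.encard_coe_eq_coe_finsetCard, Nat.card_Icc]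
  simp

end

theorem nthPosZero_eq {f : ℝ → ℝ} {k : ℕ} {y : ℝ} (h : IsNthPosZero f k y) :
    nthPosZero f k = y := by
  have hex : ∃ y, IsNthPosZero f k y := ⟨y, h⟩
  rw [nthPosZero, dif_pos hex]
  exact hex.choose_spec.unique h

/-! ### The zero curves of the cross product -/

section
variable {ν : ℝ}

theorem sq_sub_nonneg (hν : 1 / 2 ≤ ν) : 0 ≤ ν ^ 2 - 1 / 4 := by nlinarith

theorem cross_eq_zero_iff (hν : 1 / 2 ≤ ν) {x y : ℝ} (hx : 1 < x) (hy : 0 < y) :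
    besselJ ν y * besselY ν (x * y) - besselJ ν (x * y) * besselY ν y = 0
      ↔ sin (phase (ν ^ 2 - 1 / 4) y (x * y)) = 0 := by
  have hc := sq_sub_nonneg hν
  have hz : 0 < x * y := mul_pos (one_pos.trans hx) hy
  have h1 : √y * √(x * y) ≠ 0 := (mul_pos (sqrt_pos.2 hy) (sqrt_pos.2 hz)).ne'
  have h2 : √(amp (ν ^ 2 - 1 / 4) y) * √(amp (ν ^ 2 - 1 / 4) (x * y)) ≠ 0 :=
    (mul_pos (sqrt_pos.2 (amp_pos hc)) (sqrt_pos.2 (amp_pos hc))).ne'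
  have h3 : 2 / π ≠ 0 := (div_pos two_pos pi_pos).ne'
  rw [← mul_eq_zero_iff_left h1, kernel_bessel hν hy hz, mul_eq_zero_iff_left h3,
    mul_eq_zero_iff_left h2]

theorem crossU_eq_zero_iff (hν : 1 / 2 ≤ ν) {x y : ℝ} (hx : 1 < x) (hy : 0 < y) :
    crossU ν x y = 0 ↔ sin (phase (ν ^ 2 - 1 / 4) y (x * y)) = 0 := by
  rw [← cross_eq_zero_iff hν hx hy, crossU,
    mul_eq_zero_iff_left (rpow_pos_of_pos (one_pos.trans hx) _).ne']

theorem cylinderU_eq_zero_iff (hν : 1 / 2 ≤ ν) {b ρ : ℝ} (hb : 1 < b) (hρ : 0 < ρ) :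
    cylinderU ν b ρ 1 = 0 ↔ sin (phase (ν ^ 2 - 1 / 4) ρ (b * ρ)) = 0 := by
  rw [← cross_eq_zero_iff hν hb hρ, cylinderU, mul_one, mul_comm ρ b]

theorem zeroCurve_spec (hν : 1 / 2 ≤ ν) {k : ℕ} (hk : 1 ≤ k) {x : ℝ} (hx : 1 < x) :
    IsNthPosZero (fun y => crossU ν x y) k (zeroCurve ν k x) ∧ 0 < zeroCurve ν k x ∧
      phase (ν ^ 2 - 1 / 4) (zeroCurve ν k x) (x * zeroCurve ν k x) = k * π := by
  have hc := sq_sub_nonneg hν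
  have hk' : (0 : ℝ) < k := by exact_mod_cast hk
  obtain ⟨y, hy, hyk⟩ := exists_phase_mul_eq hc hx (mul_pos hk' pi_pos)
  have h := isNthPosZero_of_phase_eq hc hx (f := fun y => crossU ν x y)
    (fun y hy => crossU_eq_zero_iff hν hx hy) hy hyk
  rw [zeroCurve, nthPosZero_eq h]
  exact ⟨h, hy, hyk⟩

theorem isNthPosZero_cylinderU (hν : 1 / 2 ≤ ν) {m : ℕ} (hm : 1 ≤ m) {b : ℝ} (hb : 1 < b) :
    IsNthPosZero (fun ρ => cylinderU ν b ρ 1) m (zeroCurve ν m b) := by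
  obtain ⟨-, h0, h1⟩ := zeroCurve_spec hν hm hb
  exact isNthPosZero_of_phase_eq (sq_sub_nonneg hν) hb
    (fun y hy => cylinderU_eq_zero_iff hν hb hy) h0 h1

theorem strictAntiOn_zeroCurve (hν : 1 / 2 ≤ ν) {k : ℕ} (hk : 1 ≤ k) :
    StrictAntiOn (zeroCurve ν k) (Ioi 1) := by
  intro x₁ hx₁ x₂ hx₂ hlt
  have hc := sq_sub_nonneg hν
  obtain ⟨-, h1, e1⟩ := zeroCurve_spec hν hk hx₁
  obtain ⟨-, h2, e2⟩ := zeroCurve_spec hν hk hx₂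
  have hx₁' : (1 : ℝ) < x₁ := hx₁
  have hx0 : 0 < x₁ := one_pos.trans hx₁'
  by_contra! hle
  have h3 := (strictMonoOn_phase_mul hc hx₁).monotoneOn h1 h2 hle
  have h4 := strictMonoOn_phase hc h2 (mem_Ioi.2 (mul_pos hx0 h2))
    (mem_Ioi.2 (mul_pos (hx0.trans hlt) h2)) (mul_lt_mul_of_pos_right hlt h2)
  simp only [e1] at h3
  rw [e2] at h4
  linarith

theorem convexOn_zeroCurve (hν : 1 / 2 ≤ ν) {k : ℕ} (hk : 1 ≤ k) :
    ConvexOn ℝ (Ioi 1) (zeroCurve ν k) := by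
  have hc := sq_sub_nonneg hν
  have hr : (0 : ℝ) < k * π := mul_pos (by exact_mod_cast hk) pi_pos
  -- the curve is the inverse of the convex decreasing function `y ↦ advance y / y`
  have hX : ∀ x, 1 < x →
      advance (ν ^ 2 - 1 / 4) (k * π) (zeroCurve ν k x) / zeroCurve ν k x = x := fun x hx => by
    obtain ⟨-, h1, e1⟩ := zeroCurve_spec hν hk hx
    obtain ⟨h2, e2⟩ := advance_spec hc h1 hr
    rw [div_eq_iff h1.ne']
    exact (strictMonoOn_phase hc h1).injOn (h1.trans h2) (mul_pos (one_pos.trans hx) h1)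
      (e2.trans e1.symm)
  refine ⟨convex_Ioi 1, fun x₁ hx₁ x₂ hx₂ a b ha hb hab => ?_⟩
  have hx := (convex_Ioi (1 : ℝ)) hx₁ hx₂ ha hb hab
  obtain ⟨-, h1, -⟩ := zeroCurve_spec hν hk hx₁
  obtain ⟨-, h2, -⟩ := zeroCurve_spec hν hk hx₂
  obtain ⟨-, h3, e3⟩ := zeroCurve_spec hν hk hx
  have hy := (convex_Ioi (0 : ℝ)) h1 h2 ha hb hab
  have hconv := (convexOn_advance_div hc hr).2 h1 h2 ha hb hab
  simp only [hX x₁ hx₁, hX x₂ hx₂] at hconv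
  set y := a • zeroCurve ν k x₁ + b • zeroCurve ν k x₂
  set x := a • x₁ + b • x₂
  have hy0 : 0 < y := hy
  obtain ⟨h4, e4⟩ := advance_spec hc hy0 hr
  rw [div_le_iff₀ hy0] at hconv
  refine ((strictMonoOn_phase_mul hc hx).le_iff_le h3 hy).1 ?_
  simp only [e3]
  exact e4.symm.le.trans ((strictMonoOn_phase hc hy0).monotoneOn (hy0.trans h4)
    (mem_Ioi.2 (mul_pos (one_pos.trans hx) hy0)) hconv)

/-- Since `1 / amp ≤ 1`, the phase grows by at most `x (y_{k+1} - y_k)` from `x y_k` to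
`x y_{k+1}`, whereas it has to grow by more than `π`. -/
theorem pi_div_lt_zeroCurve_sub (hν : 1 / 2 ≤ ν) {k : ℕ} (hk : 1 ≤ k) {x : ℝ} (hx : 1 < x) :
    π / x < zeroCurve ν (k + 1) x - zeroCurve ν k x := by
  have hc := sq_sub_nonneg hν
  have hx0 : 0 < x := one_pos.trans hx
  obtain ⟨-, h1, e1⟩ := zeroCurve_spec hν hk hx
  obtain ⟨-, h2, e2⟩ := zeroCurve_spec hν (Nat.le_add_left 1 k) hx
  set y := zeroCurve ν k x
  set y' := zeroCurve ν (k + 1) x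
  have hlt : y < y' := by
    refine ((strictMonoOn_phase_mul hc hx).lt_iff_lt h1 h2).1 ?_
    simp only [e1, e2]
    push_cast
    linarith [pi_pos]
  have a1 := phase_add hc h1 h2 (mul_pos hx0 h2)
  have a2 := phase_add hc h1 (mul_pos hx0 h1) (mul_pos hx0 h2)
  have a3 := phase_pos hc h1 hlt
  have a4 := phase_le_sub hc (mul_pos hx0 h1) (mul_le_mul_of_nonneg_left hlt.le hx0.le)
  push_cast at e2
  rw [div_lt_iff₀ hx0]
  linarith

theorem pi_div_two_mul_sub_one_lt (hν : 1 / 2 ≤ ν) {k : ℕ} (hk : 1 ≤ k) {x : ℝ} (hx : 1 < x) :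
    π / (2 * x - 1) < zeroCurve ν (k + 1) x - zeroCurve ν k x :=
  (div_lt_div_of_pos_left pi_pos (by linarith) (by linarith)).trans
    (pi_div_lt_zeroCurve_sub hν hk hx)

end

end BesselCross

theorem mainTheorem6 (ν : ℝ) (hν : 1 / 2 ≤ ν) :
    -- the zero curves are well defined on `(1, ∞)`
    (∀ k : ℕ, 1 ≤ k → ∀ x : ℝ, 1 < x →
      IsNthPosZero (fun y => crossU ν x y) k (zeroCurve ν k x)) ∧
    -- they are strictly decreasing and convex
    (∀ k : ℕ, 1 ≤ k →
      StrictAntiOn (zeroCurve ν k) (Set.Ioi 1) ∧ ConvexOn ℝ (Set.Ioi 1) (zeroCurve ν k)) ∧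
    -- the spacing of consecutive zero curves
    (∀ k : ℕ, 2 ≤ k → ∀ x : ℝ, 1 < x →
      zeroCurve ν (k + 1) x - zeroCurve ν k x > Real.pi / (2 * x - 1)) ∧
    -- the resulting estimate for the zeros `ρ_{ν,m}` of `ρ ↦ U_ν(ρ, 1)`
    (∀ b : ℝ, 1 < b →
      (∀ m : ℕ, 1 ≤ m → IsNthPosZero (fun ρ => cylinderU ν b ρ 1) m (rhoZero ν b m)) ∧
      (∀ m : ℕ, 2 ≤ m → rhoZero ν b (m + 1) - rhoZero ν b m > Real.pi / (2 * b - 1))) := by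
  have hρ : ∀ b : ℝ, 1 < b → ∀ m : ℕ, 1 ≤ m → rhoZero ν b m = zeroCurve ν m b :=
    fun b hb m hm => BesselCross.nthPosZero_eq (BesselCross.isNthPosZero_cylinderU hν hm hb)
  refine ⟨fun k hk x hx => (BesselCross.zeroCurve_spec hν hk hx).1,
    fun k hk => ⟨BesselCross.strictAntiOn_zeroCurve hν hk, BesselCross.convexOn_zeroCurve hν hk⟩,
    fun k hk x hx => BesselCross.pi_div_two_mul_sub_one_lt hν (by omega) hx,
    fun b hb => ⟨fun m hm => ?_, fun m hm => ?_⟩⟩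
  · rw [hρ b hb m hm]
    exact BesselCross.isNthPosZero_cylinderU hν hm hb
  · rw [hρ b hb m (by omega), hρ b hb (m + 1) (by omega)]
    exact BesselCross.pi_div_two_mul_sub_one_lt hν (by omega) hb
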